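/- Let $\mathbb F_q$ be a finite field with $q$ elements and let $V$ be an $\mathbb F_q$-vector space of finite dimension $r\ge 1$. Let $S_V$ be the symmetric algebra of $V$ over $\mathbb F_q$, let $K_V$ be its field of quotients, and let $R_V\subset K_V$ be the $\mathbb F_q$-subalgebra generated by the elements $\frac1v$ for all $v\in V\setminus\{0\}$. Both $S_V$ and $R_V$ are graded so that every $v\in V\setminus\{0\}$ has degree $1$ and every $\frac1v$ has degree $-1$. Let $G:=\mathrm{Aut}_{\mathbb F_q}(V)\cong\mathrm{GL}_r(\mathbb F_q)$, let $G'\subset G$ be the subgroup of automorphisms of determinant $1$, and let $U$ be a maximal unipotent subgroup of $G$. These groups act on $S_V$, $K_V$ and $R_V$ by functoriality. There is a basis $X_1,\dots,X_r$ of $V$ in which $U$ corresponds to the group of all upper triangular matrices with all diagonal entries equal to $1$. For any such basis put $V_{i}:=\langle X_1,\dots,X_i\rangle$ for $0\le i\le r$ and $$f_i:=\sum_{u\in V_{i-1}}\frac1{X_i+u}\in R_V,\qquad g_i:=\prod_{u\in V_{i-1}}(X_i+u)\in S_V\qquad(1\le i\le r).$$ For $0\le i\le r-1$ let $k_i\in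 S_V$ be the coefficient of $T^{q^i}$ in $k(T):=\prod_{v\in V}(T-v)\in S_V[T]$, and put $h_i:=\frac{k_i}{k_0}$ for $1\le i\le r-1$ and $h_r:=\frac1{k_0}$. Let $k'_0\in S_V$ be the product of one non-zero element from every $1$-dimensional subspace of $V$ (for an arbitrary choice of these elements), and put $h'_r:=\frac1{k'_0}$. Then the following subrings of invariants are generated over $\mathbb F_q$ by the indicated elements, which are algebraically independent over $\mathbb F_q$ and homogeneous of the indicated degrees: (a) $R_V^U=\mathbb F_q[f_1,\dots,f_r]$ with all degrees $-1$. (b) $S_V^U=\mathbb F_q[g_1,\dots,g_r]$ with respective degrees $1,q,\dots,q^{r-1}$. (c) $R_V^G=\mathbb F_q[h_1,\dots,h_r]$ with respective degrees $1-q,1-q^2,\dots,1-q^r$. (d) $S_V^G=\mathbb F_q[k_0,\dots,k_{r-1}]$ with respective degrees $q^r-1,q^r-q,\dots,q^r-q^{r-1}$. (e) $R_V^{G'}=\mathbb F_q[h_1,\dots,h_{r-1},h'_r]$ with respective degrees $1-q,\dots,1-q^{r-1},\frac{1-q^r}{q-1}$. (f) $S_V^{G'}=\mathbb F_q[k'_0,k_1,\dots,k_{r-1}]$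 with respective degrees $\frac{q^r-1}{q-1},q^r-q,\dots,q^r-q^{r-1}$. -/

import Mathlib

noncomputable section

namespace RecipInv

variable (F : Type*) [Field F] (V : Type*) [AddCommGroup V] [Module F V]

/-- The symmetric algebra `S_V` of `V` over `F`. -/
abbrev S : Type _ := SymmetricAlgebra F V

/-- The field of quotients `K_V` of `S_V`. -/
abbrev K : Type _ := FractionRing (S F V)

variable {V}

/-- A vector `v` as an element of `K_V`. -/
def vec (v : V) : K F V := algebraMap (S F V) (K F V) (SymmetricAlgebra.ι F V v)

variable (V)

/-- The set of all reciprocals `1 / v` in `K_V` of nonzero vectors `v`. -/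
def recips : Set (K F V) := {x | ∃ v : V, v ≠ 0 ∧ x = (vec F v)⁻¹}

/-- The subalgebra `R_V` of `K_V` generated by all `1 / v` with `v ≠ 0`. -/
def R : Subalgebra F (K F V) := Algebra.adjoin F (recips F V)

/-- The homogeneous part of degree `n` of `S_V`; all vectors have degree `1`. -/
def gradeS (n : ℤ) : Submodule F (S F V) :=
  if 0 ≤ n then LinearMap.range (SymmetricAlgebra.ι F V) ^ n.toNat else ⊥

/-- The homogeneous part of degree `n` of `R_V`; all `1 / v` have degree `-1`. -/
def gradeR (n : ℤ) : Submodule F (K F V) :=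
  if n ≤ 0 then Submodule.span F (recips F V) ^ (-n).toNat else ⊥

variable {F V}

/-- The automorphism of `S_V` induced by an automorphism `g` of `V`. -/
def actS (g : V ≃ₗ[F] V) : S F V ≃ₐ[F] S F V :=
  AlgEquiv.ofAlgHom
    (SymmetricAlgebra.lift (SymmetricAlgebra.ι F V ∘ₗ (g : V →ₗ[F] V)))
    (SymmetricAlgebra.lift (SymmetricAlgebra.ι F V ∘ₗ (g.symm : V →ₗ[F] V)))
    (SymmetricAlgebra.algHom_ext (by ext v; simp))
    (SymmetricAlgebra.algHom_ext (by ext v; simp))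

/-- The automorphism of `K_V` induced by an automorphism `g` of `V`. -/
def actK (g : V ≃ₗ[F] V) : K F V ≃ₐ[F] K F V :=
  IsFractionRing.algEquivOfAlgEquiv (actS g)

theorem actS_ι (g : V ≃ₗ[F] V) (v : V) :
    actS g (SymmetricAlgebra.ι F V v) = SymmetricAlgebra.ι F V (g v) := by
  simp [actS]

theorem actK_vec (g : V ≃ₗ[F] V) (v : V) : actK g (vec F v) = vec F (g v) := by
  simp [actK, vec, actS_ι]

/-- The action on `K_V` preserves `R_V`. -/
theorem actK_mem_R (g : V ≃ₗ[F] V) {x : K F V} (hx : x ∈ R F V) : actK g x ∈ R F V := by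
  have h : (R F V).map (actK g : K F V →ₐ[F] K F V) ≤ R F V := by
    rw [R, AlgHom.map_adjoin]
    refine Algebra.adjoin_mono ?_
    rintro _ ⟨_, ⟨v, hv, rfl⟩, rfl⟩
    exact ⟨g v, by simpa using hv, by simp [actK_vec]⟩
  exact h ⟨x, hx, rfl⟩

/-- The subring of invariants of `S_V` under a group `H` of automorphisms of `V`. -/
def invS (H : Subgroup (V ≃ₗ[F] V)) : Subalgebra F (S F V) where
  carrier := {x | ∀ g ∈ H, actS g x = x}
  mul_mem' hx hy g hg := by rw [map_mul, hx g hg, hy g hg]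
  add_mem' hx hy g hg := by rw [map_add, hx g hg, hy g hg]
  algebraMap_mem' c g _ := (actS g).commutes c

/-- The subring of invariants of `R_V` under a group `H` of automorphisms of `V`,
as a subalgebra of `K_V`. -/
def invR (H : Subgroup (V ≃ₗ[F] V)) : Subalgebra F (K F V) where
  carrier := {x | x ∈ R F V ∧ ∀ g ∈ H, actK g x = x}
  mul_mem' hx hy := ⟨mul_mem hx.1 hy.1, fun g hg => by rw [map_mul, hx.2 g hg, hy.2 g hg]⟩
  add_mem' hx hy := ⟨add_mem hx.1 hy.1, fun g hg => by rw [map_add, hx.2 g hg, hy.2 g hg]⟩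
  algebraMap_mem' c := ⟨(R F V).algebraMap_mem c, fun g _ => (actK g).commutes c⟩

/-- The subalgebra `A` is generated by the algebraically independent family `x`, where
each `x i` is homogeneous of degree `d i` with respect to the homogeneous parts `gr`. -/
def IsPolynomialOn {B : Type*} [CommRing B] [Algebra F B] (A : Subalgebra F B)
    (gr : ℤ → Submodule F B) {r : ℕ} (x : Fin r → B) (d : Fin r → ℤ) : Prop :=
  A = Algebra.adjoin F (Set.range x) ∧ AlgebraicIndependent F x ∧ ∀ i, x i ∈ gr (d i)

/-- All elements of the subgroup `H` of `Aut(V)` are unipotent. -/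
def IsUnipotentSubgroup (H : Subgroup (V ≃ₗ[F] V)) : Prop :=
  ∀ g ∈ H, IsNilpotent ((g : V →ₗ[F] V) - LinearMap.id)

/-- In the basis `b`, the subgroup `U` corresponds to the group of all upper triangular matrices
with all diagonal entries equal to `1`: it consists of all `g` sending each `b i` to
`b i + u` with `u` in the span of the `b j` for `j < i`. -/
def IsUnitriangularIn {r : ℕ} (U : Subgroup (V ≃ₗ[F] V)) (b : Module.Basis (Fin r) F V) : Prop :=
  ∀ g : V ≃ₗ[F] V,
    g ∈ U ↔ ∀ i, g (b i) - b i ∈ Submodule.span F (b '' Set.Iio i)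

/-- `f i` is the sum of all `1 / (b i + u)` for `u` in the span of the `b j` with `j < i`. -/
def f {r : ℕ} (b : Module.Basis (Fin r) F V) (i : Fin r) : K F V :=
  ∑ᶠ u : Submodule.span F (b '' Set.Iio i), (vec F (b i + (u : V)))⁻¹

/-- `g i` is the product of all `b i + u` for `u` in the span of the `b j` with `j < i`. -/
def g {r : ℕ} (b : Module.Basis (Fin r) F V) (i : Fin r) : S F V :=
  ∏ᶠ u : Submodule.span F (b '' Set.Iio i), SymmetricAlgebra.ι F V (b i + (u : V))

variable (F V)

/-- The polynomial `k(T)`, the product of all `T - v` for `v` in `V`. -/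
def kPoly : Polynomial (S F V) :=
  ∏ᶠ v : V, (Polynomial.X - Polynomial.C (SymmetricAlgebra.ι F V v))

/-- The Dickson invariant `k_i`: the coefficient of `T ^ (q ^ i)` in `k(T)`, `q = |F|`. -/
def k (i : ℕ) : S F V := (kPoly F V).coeff (Nat.card F ^ i)

/-- `h_i = k_i / k_0` for `i < dim V`, and `h_i = 1 / k_0` for `i = dim V`. -/
def h (i : ℕ) : K F V :=
  (if i < Module.finrank F V then algebraMap (S F V) (K F V) (k F V i) else 1) /
    algebraMap (S F V) (K F V) (k F V 0)

variable {F V}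

/-- `s` chooses a nonzero element from every one-dimensional subspace of `V`. -/
def IsLineSection (s : Projectivization F V → V) : Prop :=
  ∀ l, s l ≠ 0 ∧ s l ∈ l.submodule

/-- `k'_0`: the product of one nonzero element from every one-dimensional subspace. -/
def k' (s : Projectivization F V → V) : S F V :=
  ∏ᶠ l, SymmetricAlgebra.ι F V (s l)

/-- `h'_r = 1 / k'_0`. -/
def h' (s : Projectivization F V → V) : K F V :=
  (algebraMap (S F V) (K F V) (k' s))⁻¹

end RecipInv

end

/-!
All six statements follow from one Galois-theoretic criterion. Write `q = |F|`. The field `K_V` is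
generated over `F` by `V`, the set of roots of the separable polynomial `k(T)`. Let `E` be a
subfield of `K_V` that contains the coefficients of `k(T)`. Then `K_V / E` is a finite Galois
extension (`isGalois_of_coeff_mem`), and each of its automorphisms permutes `V` linearly, hence is
induced by an element of `Aut(V)` (`exists_eq_actK`). If `E` is generated by `r = dim V` elements
`x i`, these form a transcendence basis, so that `F[x]` is a polynomial ring and therefore
integrally closed in `E`. If moreover only elements of `H` fix all of `E`, then every `H`-invariant
lies in `E`, and lies in `F[x]` as soon as it is integral over `F[x]`
(`algebraicIndependent_and_mem_adjoin`). No degree of a field extension has to be computed.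

Integrality is read off from `k(T)`. Its roots are the vectors, so `S_V` is integral over any ring
containing its coefficients. The reversed polynomial of `k(T) / (k_0 T)` is monic with the
reciprocals of the nonzero vectors as roots, so `R_V` is integral over any ring containing the
quotients of the coefficients by `k_0`. This reduces the theorem to three verifications in each
case: the generators are invariant and homogeneous, they generate the required coefficients, and
only the given group fixes them.

For the unitriangular group, let `P_i` be the product of all `T - v` for `v` in the `i`-th step
`V_i` of the flag of the basis. Then `P_i(b i) = g i`, and the additivity of `P_i` gives
`P_{i+1} = P_i ^ q - g i ^ (q - 1) * P_i` (`vanishingPoly_flag_succ`). So all `P_i` are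
`q`-linearized with coefficients in `F[g]`, and an automorphism that fixes the `g i` moves `b i` by
a root of `P_i`, that is, by a vector of `V_i`. As the derivative of `P_i` is its linear coefficient
`c_i`, the logarithmic derivative of `P_i` at `b i` is `f i = c_i / g i`. The polynomials
`N_i = P_i / c_i` then satisfy `N_{i+1} = N_i - f i ^ (q - 1) * N_i ^ q`, which shows that their
coefficients lie in `F[f]`.

For the special linear group one needs `γ k'_0 = det(γ) k'_0` (`actS_k'`). Up to a constant, `k_0`
is the `(q - 1)`-th power of `k'_0` and also that of the product of the `g i` in any basis. Since
`S_V` is integrally closed, the two products agree up to a constant, and `γ` multiplies `k'_0` by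
a constant. The constant is the determinant for diagonal `γ` by inspection of the `g i`, and it
is `1` for transvections because their order divides `q`.

Finally, a unipotent group is a `p`-group, hence fixes a nonzero vector in every nonzero quotient
`V / W` on which it acts. Inductively this yields a basis in which the group is unitriangular, and a
maximal one is the whole unitriangular group (`exists_isUnitriangularIn`).
-/

noncomputable section

namespace RecipInv

open Polynomial

/-! ### Linearized polynomials over a finite field -/

section Linearized

variable {F : Type*} [Field F]

theorem add_pow_natCard [Finite F] {B : Type*} [CommRing B] [Algebra F B] (x y : B) :
    (x + y) ^ Nat.card F = x ^ Nat.card F + y ^ Nat.card F := by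
  have := Fintype.ofFinite F
  rw [Nat.card_eq_fintype_card]
  exact map_add (FiniteField.frobeniusAlgHom F B) x y

theorem smul_pow_natCard [Finite F] {B : Type*} [CommRing B] [Algebra F B] (a : F) (x : B) :
    (a • x) ^ Nat.card F = a • x ^ Nat.card F := by
  have := Fintype.ofFinite F
  rw [Nat.card_eq_fintype_card]
  exact map_smul (FiniteField.frobeniusAlgHom F B) a x

theorem sub_pow_natCard_pow [Finite F] {B : Type*} [CommRing B] [Algebra F B] (x y : B) (j : ℕ) :
    (x - y) ^ Nat.card F ^ j = x ^ Nat.card F ^ j - y ^ Nat.card F ^ j := by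
  induction j with
  | zero => simp
  | succ j ih =>
    have := Fintype.ofFinite F
    have h := map_sub (FiniteField.frobeniusAlgHom F B) (x ^ Nat.card F ^ j) (y ^ Nat.card F ^ j)
    simp only [FiniteField.coe_frobeniusAlgHom, ← Nat.card_eq_fintype_card] at h
    rw [pow_succ, pow_mul, ih, h, ← pow_mul, ← pow_mul]

theorem smul_pow_natCard_pow [Finite F] {B : Type*} [CommRing B] [Algebra F B] (a : F) (x : B)
    (j : ℕ) : (a • x) ^ Nat.card F ^ j = a • x ^ Nat.card F ^ j := by
  induction j with
  | zero => simp
  | succ j ih => rw [pow_succ, pow_mul, ih, smul_pow_natCard, ← pow_mul]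

/-- The homogeneous form of the factorization of `T ^ q - T` over the field with `q` elements. -/
theorem finprod_sub_smul [Finite F] {B : Type*} [CommRing B] [Algebra F B] (y : B) {z : B}
    (hz : IsUnit z) : ∏ᶠ a : F, (y - a • z) = y ^ Nat.card F - z ^ (Nat.card F - 1) * y := by
  have := Fintype.ofFinite F
  obtain ⟨z, rfl⟩ := hz
  obtain ⟨t, rfl⟩ : ∃ t, y = z * t := ⟨(z⁻¹ : Bˣ) * y, by simp⟩
  have hF : (X ^ Fintype.card F - X : F[X]) = ∏ a : F, (X - C a) := by
    have hd := FiniteField.X_pow_card_sub_X_natDegree_eq F (Fintype.one_lt_card (α := F))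
    have hm : (X ^ Fintype.card F - X : F[X]).Monic := by
      apply monic_X_pow_sub
      rw [degree_X]
      exact_mod_cast Fintype.one_lt_card (α := F)
    have := prod_multiset_X_sub_C_of_monic_of_roots_card_eq hm (by
      rw [FiniteField.roots_X_pow_card_sub_X, hd]; rfl)
    rw [← this, FiniteField.roots_X_pow_card_sub_X]
    rfl
  have hB := congrArg (aeval t) hF
  simp only [map_sub, map_pow, aeval_X, map_prod, aeval_C] at hB
  have hq : (z : B) ^ Fintype.card F = z ^ (Fintype.card F - 1) * z := by
    rw [← pow_succ, Nat.sub_add_cancel Fintype.card_pos]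
  calc ∏ᶠ a : F, ((z : B) * t - a • (z : B)) = ∏ a : F, (z * (t - algebraMap F B a)) := by
        rw [finprod_eq_prod_of_fintype]
        refine Finset.prod_congr rfl fun a _ => ?_
        rw [Algebra.smul_def]; ring
    _ = z ^ Fintype.card F * (t ^ Fintype.card F - t) := by
        rw [Finset.prod_mul_distrib, ← hB, Finset.prod_const, Finset.card_univ]
    _ = _ := by rw [Nat.card_eq_fintype_card, mul_pow, mul_sub, hq]; ring

variable {L : Type*} [Field L] [Algebra F L]

/-- The `q`-linearized polynomials with coefficients in a subalgebra `A` of `L`, that is, the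
polynomials `∑ j, c j * T ^ (q ^ j)` with all `c j` in `A`, where `q` is the order of `F`. -/
def linearized (A : Subalgebra F L) : Submodule A L[X] :=
  Submodule.span A (Set.range fun j : ℕ => X ^ Nat.card F ^ j)

variable {A : Subalgebra F L} {P : L[X]}

theorem C_mul_mem_linearized {a : L} (ha : a ∈ A) (hP : P ∈ linearized A) :
    C a * P ∈ linearized A := by
  have h := (linearized A).smul_mem ⟨a, ha⟩ hP
  rwa [show (⟨a, ha⟩ : A) • P = a • P from rfl, smul_eq_C_mul] at h

theorem X_mem_linearized : (X : L[X]) ∈ linearized A :=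
  Submodule.subset_span ⟨0, by simp⟩

@[elab_as_elim]
theorem linearized_induction {p : L[X] → Prop} (hX : ∀ j : ℕ, p (X ^ Nat.card F ^ j))
    (zero : p 0) (add : ∀ P Q, p P → p Q → p (P + Q)) (smul : ∀ a ∈ A, ∀ P, p P → p (C a * P))
    (hP : P ∈ linearized A) : p P := by
  refine Submodule.span_induction ?_ zero (fun P Q _ _ => add P Q) (fun a P _ h => ?_) hP
  · rintro _ ⟨j, rfl⟩
    exact hX j
  · rw [show a • P = (a : L) • P from rfl, smul_eq_C_mul]
    exact smul a a.2 P h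

theorem coeff_mem_of_mem_linearized (hP : P ∈ linearized A) (n : ℕ) : P.coeff n ∈ A := by
  refine linearized_induction (fun j => ?_) (by simp) (fun P Q hP hQ => ?_) (fun a ha P hP => ?_) hP
  · rw [coeff_X_pow]
    split_ifs
    exacts [one_mem _, zero_mem _]
  · rw [coeff_add]; exact add_mem hP hQ
  · rw [coeff_C_mul]; exact mul_mem ha hP

theorem coeff_eq_zero_of_mem_linearized (hP : P ∈ linearized A) {n : ℕ}
    (hn : ∀ j, n ≠ Nat.card F ^ j) : P.coeff n = 0 := by
  refine linearized_induction (fun j => ?_) (by simp) (fun P Q hP hQ => ?_) (fun a _ P hP => ?_) hP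
  · rw [coeff_X_pow, if_neg (hn j)]
  · rw [coeff_add, hP, hQ, add_zero]
  · rw [coeff_C_mul, hP, mul_zero]

variable [Finite F]

theorem pow_mem_linearized (hP : P ∈ linearized A) : P ^ Nat.card F ∈ linearized A := by
  refine linearized_induction (fun j => ?_) ?_ (fun P Q hP hQ => ?_) (fun a ha P hP => ?_) hP
  · rw [← pow_mul, ← pow_succ]
    exact Submodule.subset_span ⟨j + 1, rfl⟩
  · rw [zero_pow Nat.card_pos.ne']
    exact zero_mem _
  · rw [add_pow_natCard]
    exact add_mem hP hQ
  · rw [mul_pow, ← C_pow]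
    exact C_mul_mem_linearized (pow_mem ha _) hP

theorem aeval_sub_of_mem_linearized {B : Type*} [CommRing B] [Algebra L B] [Algebra F B]
    (hP : P ∈ linearized A) (x y : B) : aeval (x - y) P = aeval x P - aeval y P := by
  refine linearized_induction (fun j => ?_) (by simp) (fun P Q hP hQ => ?_) (fun a _ P hP => ?_) hP
  · simp [sub_pow_natCard_pow]
  · simp only [map_add, hP, hQ]; ring
  · simp only [map_mul, aeval_C, hP, mul_sub]

theorem aeval_smul_of_mem_linearized {B : Type*} [CommRing B] [Algebra L B] [Algebra F B]
    (hP : P ∈ linearized A) (a : F) (x : B) : aeval (a • x) P = a • aeval x P := by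
  refine linearized_induction (fun j => ?_) (by simp) (fun P Q hP hQ => ?_) (fun a _ P hP => ?_) hP
  · simp [smul_pow_natCard_pow]
  · simp only [map_add, hP, hQ, smul_add]
  · simp only [map_mul, aeval_C, hP, mul_smul_comm]

theorem derivative_of_mem_linearized (hP : P ∈ linearized A) :
    derivative P = C (P.coeff 1) := by
  refine linearized_induction (fun j => ?_) (by simp) (fun P Q hP hQ => ?_) (fun a _ P hP => ?_) hP
  · rcases j with _ | j
    · simp
    · have hq : (Nat.card F : L) = 0 := by
        have := Fintype.ofFinite F
        rw [← map_natCast (algebraMap F L), Nat.card_eq_fintype_card, FiniteField.cast_card_eq_zero,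
          map_zero]
      have h1 : 1 ≠ Nat.card F ^ (j + 1) :=
        (Nat.one_lt_pow (Nat.succ_ne_zero j) Finite.one_lt_card).ne
      rw [derivative_X_pow, coeff_X_pow, if_neg h1]
      simp [hq]
  · simp [hP, hQ]
  · simp [hP]

end Linearized

/-! ### Polynomials vanishing on a finite subspace -/

section Vanishing

variable {F : Type*} [Field F] {V : Type*} [AddCommGroup V] [Module F V]
  {L : Type*} [Field L] [Algebra F L]

/-- The product of all `T - φ w` for `w` in the subspace `W`. -/
def vanishingPoly (φ : V →ₗ[F] L) (W : Submodule F V) : L[X] :=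
  ∏ᶠ w : W, (X - C (φ w))

variable (φ : V →ₗ[F] L) (W : Submodule F V)

theorem vanishingPoly_bot : vanishingPoly φ ⊥ = X := by
  rw [vanishingPoly, finprod_unique, Subsingleton.elim default (0 : (⊥ : Submodule F V))]
  simp

variable [Finite V]

theorem vanishingPoly_monic : (vanishingPoly φ W).Monic := by
  have := Fintype.ofFinite W
  rw [vanishingPoly, finprod_eq_prod_of_fintype]
  exact monic_prod_of_monic _ _ fun w _ => monic_X_sub_C _

theorem vanishingPoly_natDegree : (vanishingPoly φ W).natDegree = Nat.card W := by
  have := Fintype.ofFinite W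
  rw [vanishingPoly, finprod_eq_prod_of_fintype,
    natDegree_prod_of_monic _ _ fun w _ => monic_X_sub_C _]
  simp

theorem eval_vanishingPoly (x : L) : (vanishingPoly φ W).eval x = ∏ᶠ w : W, (x - φ w) := by
  have := Fintype.ofFinite W
  rw [vanishingPoly, finprod_eq_prod_of_fintype, finprod_eq_prod_of_fintype, eval_prod]
  simp

theorem eval_vanishingPoly_eq_zero {x : L} :
    (vanishingPoly φ W).eval x = 0 ↔ ∃ w ∈ W, x = φ w := by
  have := Fintype.ofFinite W
  rw [eval_vanishingPoly, finprod_eq_prod_of_fintype, Finset.prod_eq_zero_iff]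
  simp [sub_eq_zero]

theorem eval_vanishingPoly_ne_zero (hφ : Function.Injective φ) {v : V} (hv : v ∉ W) :
    (vanishingPoly φ W).eval (φ v) ≠ 0 := by
  rw [Ne, eval_vanishingPoly_eq_zero]
  rintro ⟨w, hw, h⟩
  exact hv (hφ h ▸ hw)

variable [Finite F] {φ W}

/-- The recursion for vanishing polynomials under adding a vector `v` to a subspace `W`. The
enlarged subspace is the union of the cosets `W + a • v`, so its polynomial is the product of the
translates `P(T) - a * P(v)` of the additive polynomial `P` of `W`. -/
theorem vanishingPoly_sup_span {A : Subalgebra F L} (hφ : Function.Injective φ)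
    (hW : vanishingPoly φ W ∈ linearized A) {v : V} (hv : v ∉ W) :
    vanishingPoly φ (W ⊔ Submodule.span F {v}) = vanishingPoly φ W ^ Nat.card F -
      C ((vanishingPoly φ W).eval (φ v)) ^ (Nat.card F - 1) * vanishingPoly φ W := by
  have := Fintype.ofFinite F
  have := Fintype.ofFinite W
  have := Fintype.ofFinite ↥(W ⊔ Submodule.span F {v})
  let e : F × W → ↥(W ⊔ Submodule.span F {v}) := fun x =>
    ⟨x.2 + x.1 • v, Submodule.add_mem_sup x.2.2 (Submodule.mem_span_singleton.2 ⟨x.1, rfl⟩)⟩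
  have he : Function.Bijective e := by
    constructor
    · rintro ⟨a, w⟩ ⟨a', w'⟩ h
      have h : (w : V) + a • v = w' + a' • v := congrArg Subtype.val h
      have ha : a = a' := by
        by_contra hne
        refine hv ?_
        have h2 : (a - a') • v ∈ W := by
          have : (a - a') • v = w' - w := by
            rw [sub_smul, sub_eq_sub_iff_add_eq_add, add_comm, h, add_comm]
          rw [this]
          exact sub_mem w'.2 w.2
        exact (W.smul_mem_iff (sub_ne_zero.2 hne)).1 h2
      subst ha
      exact Prod.ext rfl (Subtype.ext (add_right_cancel h))
    · rintro ⟨x, hx⟩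
      obtain ⟨w, hw, y, hy, rfl⟩ := Submodule.mem_sup.1 hx
      obtain ⟨a, rfl⟩ := Submodule.mem_span_singleton.1 hy
      exact ⟨(a, ⟨w, hw⟩), rfl⟩
  have hu : IsUnit (C ((vanishingPoly φ W).eval (φ v))) :=
    isUnit_C.2 (eval_vanishingPoly_ne_zero φ W hφ hv).isUnit
  rw [← finprod_sub_smul _ hu, finprod_eq_prod_of_fintype]
  conv_lhs => rw [vanishingPoly, finprod_eq_prod_of_fintype]
  rw [← Fintype.prod_bijective e he (fun x => X - C (φ (e x))) _ (fun _ => rfl),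
    Fintype.prod_prod_type]
  refine Finset.prod_congr rfl fun a _ => ?_
  have h := aeval_sub_of_mem_linearized hW (X : L[X]) (a • C (φ v))
  rw [aeval_smul_of_mem_linearized hW, aeval_X_left_apply,
    show aeval (C (φ v)) (vanishingPoly φ W) = C ((vanishingPoly φ W).eval (φ v)) from
      (aeval_algebraMap_apply_eq_algebraMap_eval _ _)] at h
  refine Eq.trans ?_ h
  rw [vanishingPoly, finprod_eq_prod_of_fintype, map_prod]
  refine Finset.prod_congr rfl fun w _ => ?_
  simp only [e, map_add, map_smul, map_sub, aeval_X, aeval_C, ← smul_C]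
  rw [show algebraMap L L[X] (φ w) = C (φ w) from rfl]
  ring

end Vanishing

/-! ### The field of quotients of the symmetric algebra -/

section FieldOfQuotients

variable {F : Type*} [Field F] {V : Type*} [AddCommGroup V] [Module F V]

theorem algebraMap_S_K_injective : Function.Injective (algebraMap (S F V) (K F V)) :=
  IsFractionRing.injective _ _

variable (F V)

/-- The inclusion `vec` of `V` into `K_V`, bundled as a linear map. -/
def vecL : V →ₗ[F] K F V :=
  (IsScalarTower.toAlgHom F (S F V) (K F V)).toLinearMap ∘ₗ SymmetricAlgebra.ι F V

variable {F V}

theorem vecL_apply (v : V) : vecL F V v = vec F v := rfl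

theorem ι_injective : Function.Injective (SymmetricAlgebra.ι F V) := by
  rw [injective_iff_map_eq_zero]
  intro v hv
  rw [← Module.forall_dual_apply_eq_zero_iff F]
  intro φ
  rw [← SymmetricAlgebra.lift_ι_apply (A := F) φ v, hv, map_zero]

theorem vecL_injective : Function.Injective (vecL F V) :=
  algebraMap_S_K_injective.comp ι_injective

theorem vecL_ne_zero {v : V} (hv : v ≠ 0) : vecL F V v ≠ 0 := by
  rw [Ne, ← map_zero (vecL F V)]
  exact fun h => hv (vecL_injective h)

theorem actK_vecL (g : V ≃ₗ[F] V) (v : V) : actK g (vecL F V v) = vecL F V (g v) :=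
  actK_vec g v

theorem actK_algebraMap (g : V ≃ₗ[F] V) (x : S F V) :
    actK g (algebraMap (S F V) (K F V) x) = algebraMap (S F V) (K F V) (actS g x) := by
  simp [actK]

theorem algHom_K_ext {B : Type*} [CommRing B] [Algebra F B] {σ τ : K F V →ₐ[F] B}
    (h : ∀ v, σ (vecL F V v) = τ (vecL F V v)) : σ = τ := by
  refine IsLocalization.algHom_ext (nonZeroDivisors (S F V)) ?_
  refine SymmetricAlgebra.algHom_ext ?_
  ext v
  exact h v

theorem adjoin_range_vecL :
    IntermediateField.adjoin F (Set.range (vecL F V)) = ⊤ := by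
  rw [eq_top_iff]
  intro x _
  have hS : ∀ a : S F V, algebraMap (S F V) (K F V) a ∈
      IntermediateField.adjoin F (Set.range (vecL F V)) := by
    intro a
    induction a using SymmetricAlgebra.induction with
    | algebraMap c =>
      rw [← IsScalarTower.algebraMap_apply]
      exact IntermediateField.algebraMap_mem _ c
    | ι v => exact IntermediateField.subset_adjoin F _ ⟨v, rfl⟩
    | mul a b ha hb => rw [map_mul]; exact mul_mem ha hb
    | add a b ha hb => rw [map_add]; exact add_mem ha hb
  obtain ⟨a, b, _, rfl⟩ := IsFractionRing.div_surjective (A := S F V) x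
  exact div_mem (hS a) (hS b)

theorem isTranscendenceBasis_vecL {ι : Type*} (b : Module.Basis ι F V) :
    IsTranscendenceBasis F (fun i => vecL F V (b i)) := by
  have h := (IsTranscendenceBasis.mvPolynomial ι F)
  have h := (SymmetricAlgebra.equivMvPolynomial b).symm.isTranscendenceBasis h
  have : Algebra.IsAlgebraic (S F V) (K F V) :=
    IsLocalization.isAlgebraic _ (nonZeroDivisors (S F V))
  have h := h.algebraMap_comp (A := K F V)
  convert h using 2 with i
  simp [vecL]

section Finite

variable [Finite V]

theorem map_kPoly :
    (kPoly F V).map (algebraMap (S F V) (K F V)) = vanishingPoly (vecL F V) ⊤ := by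
  have := Fintype.ofFinite V
  have := Fintype.ofFinite (⊤ : Submodule F V)
  rw [kPoly, vanishingPoly, finprod_eq_prod_of_fintype, finprod_eq_prod_of_fintype,
    Polynomial.map_prod]
  refine (Fintype.prod_equiv (Submodule.topEquiv (R := F) (M := V)).toEquiv _ _ fun w => ?_).symm
  simp [vecL]

theorem algebraMap_k (i : ℕ) : algebraMap (S F V) (K F V) (k F V i) =
    (vanishingPoly (vecL F V) ⊤).coeff (Nat.card F ^ i) := by
  rw [k, ← map_kPoly, coeff_map]

theorem map_vanishingPoly_actK (g : V ≃ₗ[F] V) (W : Submodule F V) (hW : ∀ w ∈ W, g w ∈ W) :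
    (vanishingPoly (vecL F V) W).map (actK g : K F V →+* K F V) = vanishingPoly (vecL F V) W := by
  have := Fintype.ofFinite W
  rw [vanishingPoly, finprod_eq_prod_of_fintype, Polynomial.map_prod]
  have hbij : Function.Bijective fun w : W => (⟨g w, hW w w.2⟩ : W) :=
    Finite.injective_iff_bijective.1 fun w w' h =>
      Subtype.ext (g.injective (congrArg Subtype.val h))
  refine Fintype.prod_bijective _ hbij _ _ fun w => ?_
  simp [actK_vecL]

end Finite

end FieldOfQuotients

/-! ### A criterion for rings of invariants to be polynomial rings -/

section Criterion

variable {F : Type*} [Field F] {V : Type*} [AddCommGroup V] [Module F V] [Finite V]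

/-- If an intermediate field `E` of `K_V / F` contains the coefficients of `k(T)`, then `K_V` is a
splitting field of the separable polynomial `k(T)` over `E`. -/
theorem isGalois_of_coeff_mem {E : IntermediateField F (K F V)}
    (hE : ∀ n, (vanishingPoly (vecL F V) ⊤).coeff n ∈ E) :
    IsGalois E (K F V) ∧ FiniteDimensional E (K F V) := by
  have := Fintype.ofFinite (⊤ : Submodule F V)
  obtain ⟨p, hp⟩ : ∃ p : E[X], p.map (algebraMap E (K F V)) = vanishingPoly (vecL F V) ⊤ := by
    rw [← mem_lifts, lifts_iff_coeff_lifts]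
    exact fun n => ⟨⟨_, hE n⟩, rfl⟩
  have hsplit : (p.map (algebraMap E (K F V))).Splits := by
    rw [hp, vanishingPoly, finprod_eq_prod_of_fintype]
    exact Splits.prod fun w _ => Splits.X_sub_C _
  have hp0 : p.map (algebraMap E (K F V)) ≠ 0 := by
    rw [hp]; exact (vanishingPoly_monic _ _).ne_zero
  have hroots : ∀ v, vecL F V v ∈ p.rootSet (K F V) := by
    intro v
    rw [mem_rootSet', aeval_def, eval₂_eq_eval_map]
    refine ⟨hp0, ?_⟩
    rw [hp, eval_vanishingPoly_eq_zero]
    exact ⟨v, trivial, rfl⟩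
  have : p.IsSplittingField E (K F V) := by
    rw [isSplittingField_iff_intermediateField]
    refine ⟨hsplit, ?_⟩
    rw [← IntermediateField.restrictScalars_eq_top_iff (K := F), eq_top_iff, ← adjoin_range_vecL,
      IntermediateField.adjoin_le_iff]
    rintro _ ⟨v, rfl⟩
    exact IntermediateField.subset_adjoin E _ (hroots v)
  have hsep : p.Separable := by
    rw [← separable_map (algebraMap E (K F V)), hp, vanishingPoly, finprod_eq_prod_of_fintype,
      separable_prod_X_sub_C_iff]
    exact fun w w' h => Subtype.ext (vecL_injective h)
  exact ⟨IsGalois.of_separable_splitting_field hsep, IsSplittingField.finiteDimensional (K F V) p⟩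

/-- Every automorphism of `K_V` over a field containing the coefficients of `k(T)` permutes the
roots of `k(T)`, which form `V`, and is therefore induced by a linear automorphism of `V`. -/
theorem exists_eq_actK {E : IntermediateField F (K F V)} [Module.Finite F V]
    (hE : ∀ n, (vanishingPoly (vecL F V) ⊤).coeff n ∈ E) (σ : K F V ≃ₐ[E] K F V) :
    ∃ g : V ≃ₗ[F] V, ∀ y, σ y = actK g y := by
  have hfix : (vanishingPoly (vecL F V) ⊤).map (σ : K F V →+* K F V) =
      vanishingPoly (vecL F V) ⊤ := by
    ext n
    rw [coeff_map]
    exact σ.commutes ⟨_, hE n⟩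
  have hv : ∀ v, ∃ w, vecL F V w = σ (vecL F V v) := by
    intro v
    have h0 : (vanishingPoly (vecL F V) ⊤).eval (vecL F V v) = 0 :=
      (eval_vanishingPoly_eq_zero _ _).2 ⟨v, trivial, rfl⟩
    have h1 : (vanishingPoly (vecL F V) ⊤).eval (σ (vecL F V v)) = 0 := by
      have h := eval_map_apply (σ : K F V →+* K F V) (p := vanishingPoly (vecL F V) ⊤)
        (vecL F V v)
      rw [hfix, h0, map_zero] at h
      exact h
    obtain ⟨w, -, hw⟩ := (eval_vanishingPoly_eq_zero _ _).1 h1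
    exact ⟨w, hw.symm⟩
  choose γ hγ using hv
  have hσ : ∀ (c : F) (x : K F V), σ (c • x) = c • σ x :=
    (AlgEquiv.restrictScalars F σ).toLinearEquiv.map_smul
  let γL : V →ₗ[F] V :=
    { toFun := γ
      map_add' := fun v w => vecL_injective (F := F) (by simp [hγ])
      map_smul' := fun c v => vecL_injective (F := F) (by simp [hγ, hσ]) }
  have hinj : Function.Injective γL := fun v w h =>
    vecL_injective (F := F) (σ.injective (by rw [← hγ, ← hγ]; exact congrArg _ h))
  refine ⟨LinearEquiv.ofInjectiveEndo γL hinj, fun y => ?_⟩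
  have h : ((AlgEquiv.restrictScalars F σ : K F V ≃ₐ[F] K F V) : K F V →ₐ[F] K F V) =
      (actK (LinearEquiv.ofInjectiveEndo γL hinj) : K F V →ₐ[F] K F V) := by
    refine algHom_K_ext (F := F) (V := V) fun v => ?_
    exact (hγ v).symm.trans (actK_vecL (LinearEquiv.ofInjectiveEndo γL hinj) v).symm
  exact DFunLike.congr_fun h y

open scoped IntermediateField.algebraAdjoinAdjoin in
/-- Let `x` be a family of `dim V` elements of `K_V` generating a field `E` that contains the
coefficients of `k(T)`. Then `K_V / E` is a finite Galois extension. Hence `x` is a transcendence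
basis, the polynomial ring generated by `x` is integrally closed in its field of quotients `E`, and
any element that is integral over it and invariant under the automorphisms fixing `x` lies in it. -/
theorem algebraicIndependent_and_mem_adjoin [Module.Finite F V] {r : ℕ}
    (hV : Module.finrank F V = r) {H : Subgroup (V ≃ₗ[F] V)} {x : Fin r → K F V}
    (hE : ∀ n, (vanishingPoly (vecL F V) ⊤).coeff n ∈ IntermediateField.adjoin F (Set.range x))
    (hH : ∀ g : V ≃ₗ[F] V,
      (∀ y ∈ IntermediateField.adjoin F (Set.range x), actK g y = y) → g ∈ H) :
    AlgebraicIndependent F x ∧ ∀ y : K F V, (∀ g ∈ H, actK g y = y) →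
      IsIntegral (Algebra.adjoin F (Set.range x)) y → y ∈ Algebra.adjoin F (Set.range x) := by
  obtain ⟨_, _⟩ := isGalois_of_coeff_mem hE
  have hbasis := isTranscendenceBasis_vecL (Module.finBasisOfFinrankEq F V hV)
  have : Algebra.IsAlgebraic (Algebra.adjoin F (Set.range x)) (K F V) :=
    Algebra.IsAlgebraic.trans _ (IntermediateField.adjoin F (Set.range x)) _
  have hx : AlgebraicIndependent F x :=
    (Algebra.IsAlgebraic.isTranscendenceBasis_of_lift_le_trdeg_of_finite F x
      hbasis.lift_cardinalMk_eq_trdeg.le).1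
  refine ⟨hx, fun y hy hint => ?_⟩
  have hyE : y ∈ (⊥ : IntermediateField (IntermediateField.adjoin F (Set.range x)) (K F V)) := by
    rw [IsGalois.mem_bot_iff_fixed]
    intro σ
    obtain ⟨g, hg⟩ := exists_eq_actK hE σ
    rw [hg]
    refine hy g (hH g fun y hyE => ?_)
    rw [← hg]
    exact σ.commutes ⟨y, hyE⟩
  obtain ⟨z, rfl⟩ := IntermediateField.mem_bot.1 hyE
  have : IsIntegrallyClosed (Algebra.adjoin F (Set.range x)) :=
    IsIntegrallyClosed.of_equiv hx.aevalEquiv.toRingEquiv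
  have hz : IsIntegral (Algebra.adjoin F (Set.range x)) z :=
    (isIntegral_algebraMap_iff (B := K F V) Subtype.val_injective).1 hint
  obtain ⟨w, rfl⟩ := IsIntegrallyClosed.isIntegral_iff.1 hz
  exact w.2

end Criterion

/-! ### Homogeneous elements -/

section Degrees

variable {F : Type*} [Field F]

theorem prod_mem_submodule_pow {B : Type*} [CommRing B] [Algebra F B] {M : Submodule F B}
    {ι : Type*} (s : Finset ι) {y : ι → B} (hy : ∀ i ∈ s, y i ∈ M) :
    ∏ i ∈ s, y i ∈ M ^ s.card := by
  classical
  induction s using Finset.induction_on with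
  | empty => simp [Submodule.one_le.1 le_rfl]
  | insert a s ha ih =>
    rw [Finset.prod_insert ha, Finset.card_insert_of_notMem ha, pow_succ']
    exact Submodule.mul_mem_mul (hy _ (Finset.mem_insert_self _ _))
      (ih fun i hi => hy i (Finset.mem_insert_of_mem hi))

theorem coeff_prod_X_sub_C_mem {B : Type*} [CommRing B] [Algebra F B] {M : Submodule F B}
    {ι : Type*} (s : Finset ι) {y : ι → B} (hy : ∀ i ∈ s, y i ∈ M) {j : ℕ} (hj : j ≤ s.card) :
    (∏ i ∈ s, (X - C (y i))).coeff j ∈ M ^ (s.card - j) := by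
  have h := Multiset.prod_X_sub_C_coeff (s.val.map y) (k := j) (by simpa using hj)
  rw [Multiset.map_map] at h
  simp only [Multiset.card_map, Finset.card_val] at h
  rw [show (∏ i ∈ s, (X - C (y i))) = (s.val.map ((fun t => X - C t) ∘ y)).prod from rfl, h,
    Finset.esymm_map_val]
  have hs : (-1 : B) ^ (s.card - j) = algebraMap F B ((-1) ^ (s.card - j)) := by simp
  rw [hs, ← Algebra.smul_def]
  refine Submodule.smul_mem _ _ (sum_mem fun t ht => ?_)
  rw [Finset.mem_powersetCard] at ht
  rw [← ht.2]
  exact prod_mem_submodule_pow t fun i hi => hy i (ht.1 hi)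

theorem coeff_prod_one_sub_C_mul_X_mem {B : Type*} [CommRing B] [Algebra F B] {M : Submodule F B}
    {ι : Type*} (s : Finset ι) {y : ι → B} (hy : ∀ i ∈ s, y i ∈ M) (j : ℕ) :
    (∏ i ∈ s, (1 - C (y i) * X)).coeff j ∈ M ^ j := by
  classical
  induction s using Finset.induction_on generalizing j with
  | empty =>
    rw [Finset.prod_empty, coeff_one]
    split_ifs with h
    · subst h; simp [Submodule.one_le.1 le_rfl]
    · exact zero_mem _
  | insert a s ha ih =>
    have ih := ih fun i hi => hy i (Finset.mem_insert_of_mem hi)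
    rw [Finset.prod_insert ha, sub_mul, one_mul, coeff_sub, mul_assoc, coeff_C_mul]
    refine sub_mem (ih j) ?_
    rcases j with _ | j
    · simp
    · rw [coeff_X_mul, pow_succ']
      exact Submodule.mul_mem_mul (hy _ (Finset.mem_insert_self _ _)) (ih j)

end Degrees

/-! ### The flag of a basis -/

section Flag

variable {F : Type*} [Field F] {V : Type*} [AddCommGroup V] [Module F V]
  {r : ℕ} (b : Module.Basis (Fin r) F V)

/-- The span of the first `n` vectors of the basis `b`. -/
def flag (n : ℕ) : Submodule F V :=
  Submodule.span F (b '' {j | (j : ℕ) < n})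

theorem span_image_Iio (i : Fin r) : Submodule.span F (b '' Set.Iio i) = flag b i := rfl

theorem flag_zero : flag b 0 = ⊥ := by
  simp [flag]

theorem flag_self : flag b r = ⊤ := by
  rw [flag, ← b.span_eq, ← Set.image_univ]
  congr 2
  ext j
  simp

theorem flag_succ (i : Fin r) : flag b (i + 1) = flag b i ⊔ Submodule.span F {b i} := by
  rw [flag, flag, ← Submodule.span_union, ← Set.image_singleton, ← Set.image_union]
  congr 2
  ext j
  simp only [Set.mem_ofPred_eq, Set.mem_union, Set.mem_singleton_iff, Fin.ext_iff]
  omega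

theorem flag_mono {m n : ℕ} (h : m ≤ n) : flag b m ≤ flag b n :=
  Submodule.span_mono (Set.image_mono fun _ hj => lt_of_lt_of_le hj h)

theorem basis_notMem_flag (i : Fin r) : b i ∉ flag b i :=
  b.linearIndependent.notMem_span_image (by simp)

theorem natCard_flag [Finite F] {n : ℕ} (hn : n ≤ r) : Nat.card (flag b n) = Nat.card F ^ n := by
  have := Module.Finite.of_basis b
  have := b.linearIndependent.comp (Fin.castLE hn) (Fin.castLE_injective hn)
  have h := finrank_span_eq_card this
  rw [Fintype.card_fin] at h
  have hs : Set.range (b ∘ Fin.castLE hn) = b '' {j | (j : ℕ) < n} := by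
    rw [Set.range_comp]
    congr 1
    ext j
    exact ⟨by rintro ⟨i, rfl⟩; exact i.2, fun hj => ⟨⟨j, hj⟩, rfl⟩⟩
  rw [Module.natCard_eq_pow_finrank (K := F), flag, ← hs, h]

theorem g_eq (i : Fin r) :
    g b i = ∏ᶠ u : flag b i, SymmetricAlgebra.ι F V (b i + (u : V)) := rfl

theorem f_eq (i : Fin r) : f b i = ∑ᶠ u : flag b i, (vec F (b i + (u : V)))⁻¹ := rfl

variable [Finite V]

theorem algebraMap_g (i : Fin r) : algebraMap (S F V) (K F V) (g b i) =
    (vanishingPoly (vecL F V) (flag b i)).eval (vecL F V (b i)) := by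
  have := Fintype.ofFinite (flag b i)
  rw [g_eq, eval_vanishingPoly, finprod_eq_prod_of_fintype, finprod_eq_prod_of_fintype, map_prod]
  refine Fintype.prod_equiv (Equiv.neg _) _ _ fun u => ?_
  simp [vecL, map_add]

theorem algebraMap_g_ne_zero (i : Fin r) : algebraMap (S F V) (K F V) (g b i) ≠ 0 := by
  rw [algebraMap_g]
  exact eval_vanishingPoly_ne_zero _ _ vecL_injective (basis_notMem_flag b i)

/-- If `A` contains all the `g i`, then the vanishing polynomials of the flag are linearized with
coefficients in `A`. -/
theorem vanishingPoly_flag_mem_linearized [Finite F] {A : Subalgebra F (K F V)}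
    (hA : ∀ i, algebraMap (S F V) (K F V) (g b i) ∈ A) {n : ℕ} (hn : n ≤ r) :
    vanishingPoly (vecL F V) (flag b n) ∈ linearized A := by
  induction n with
  | zero => rw [flag_zero, vanishingPoly_bot]; exact X_mem_linearized
  | succ n ih =>
    have ih := ih (by omega)
    have h := flag_succ b ⟨n, hn⟩
    dsimp only at h
    rw [h, vanishingPoly_sup_span vecL_injective ih (basis_notMem_flag b ⟨n, hn⟩), ← C_pow]
    have hg := algebraMap_g b ⟨n, hn⟩
    dsimp only at hg
    rw [← hg]
    exact sub_mem (pow_mem_linearized ih) (C_mul_mem_linearized (pow_mem (hA _) _) ih)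

/-- The recursion for the vanishing polynomials of the flag. -/
theorem vanishingPoly_flag_succ [Finite F] (i : Fin r) :
    vanishingPoly (vecL F V) (flag b (i + 1)) =
      vanishingPoly (vecL F V) (flag b i) ^ Nat.card F -
        C (algebraMap (S F V) (K F V) (g b i) ^ (Nat.card F - 1)) *
          vanishingPoly (vecL F V) (flag b i) := by
  have h := vanishingPoly_flag_mem_linearized b (A := ⊤) (fun _ => trivial) i.2.le
  rw [flag_succ, vanishingPoly_sup_span vecL_injective h (basis_notMem_flag b i), C_pow,
    algebraMap_g]

/-- The linear coefficient of the vanishing polynomial of the `n`-th step of the flag. -/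
def linCoeff (n : ℕ) : K F V := (vanishingPoly (vecL F V) (flag b n)).coeff 1

theorem linCoeff_zero : linCoeff b 0 = 1 := by
  rw [linCoeff, flag_zero, vanishingPoly_bot, coeff_X_one]

theorem linCoeff_succ [Finite F] (i : Fin r) : linCoeff b (i + 1) =
    -algebraMap (S F V) (K F V) (g b i) ^ (Nat.card F - 1) * linCoeff b i := by
  rw [linCoeff, vanishingPoly_flag_succ, coeff_sub, coeff_C_mul, ← linCoeff]
  have hP : (vanishingPoly (vecL F V) (flag b i)).coeff 0 = 0 := by
    rw [coeff_zero_eq_eval_zero, eval_vanishingPoly_eq_zero]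
    exact ⟨0, zero_mem _, by simp⟩
  have hX : X ∣ vanishingPoly (vecL F V) (flag b i) := X_dvd_iff.2 hP
  have hX2 : X ^ 2 ∣ vanishingPoly (vecL F V) (flag b i) ^ Nat.card F :=
    (pow_dvd_pow _ Finite.one_lt_card).trans (pow_dvd_pow_of_dvd hX _)
  rw [X_pow_dvd_iff.1 hX2 1 one_lt_two]
  ring

theorem linCoeff_ne_zero [Finite F] {n : ℕ} (hn : n ≤ r) : linCoeff b n ≠ 0 := by
  induction n with
  | zero => rw [linCoeff_zero]; exact one_ne_zero
  | succ n ih =>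
    have h := linCoeff_succ b ⟨n, hn⟩
    dsimp only at h
    rw [h]
    exact mul_ne_zero (neg_ne_zero.2 (pow_ne_zero _ (algebraMap_g_ne_zero b _))) (ih (by omega))

theorem linCoeff_mem [Finite F] {A : Subalgebra F (K F V)}
    (hA : ∀ i, algebraMap (S F V) (K F V) (g b i) ∈ A) {n : ℕ} (hn : n ≤ r) :
    linCoeff b n ∈ A :=
  coeff_mem_of_mem_linearized (vanishingPoly_flag_mem_linearized b hA hn) 1

/-- `f i` is the logarithmic derivative at `b i` of the vanishing polynomial of the previous step
of the flag, whose derivative is constant. -/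
theorem f_mul_g [Finite F] (i : Fin r) :
    f b i * algebraMap (S F V) (K F V) (g b i) = linCoeff b i := by
  classical
  have := Fintype.ofFinite (flag b i)
  have h := vanishingPoly_flag_mem_linearized b (A := ⊤) (fun _ => trivial) i.2.le
  have hd := derivative_of_mem_linearized h
  have hne : ∀ u : flag b i, vecL F V (b i) - vecL F V u ≠ 0 := by
    intro u h0
    rw [sub_eq_zero] at h0
    have h0 := vecL_injective h0
    exact basis_notMem_flag b i (h0 ▸ u.2)
  rw [linCoeff, ← eval_C (x := vecL F V (b i)) (a := (vanishingPoly _ _).coeff 1), ← hd,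
    algebraMap_g, eval_vanishingPoly, vanishingPoly, finprod_eq_prod_of_fintype,
    finprod_eq_prod_of_fintype, derivative_prod_finset, eval_finsetSum, f_eq,
    finsum_eq_sum_of_fintype, Finset.sum_mul]
  refine Fintype.sum_equiv (Equiv.neg _) _ _ fun u => ?_
  have hu := hne (-u)
  rw [← Finset.mul_prod_erase Finset.univ _ (Finset.mem_univ (-u)), ← vecL_apply]
  have h2 : vecL F V (b i + u) = vecL F V (b i) - vecL F V ((-u : flag b i) : V) := by simp
  rw [h2, inv_mul_cancel_left₀ hu]
  simp [eval_prod]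

theorem f_ne_zero [Finite F] (i : Fin r) : f b i ≠ 0 := by
  intro h
  have := f_mul_g b i
  rw [h, zero_mul] at this
  exact linCoeff_ne_zero b i.2.le this.symm

/-- If `A` contains all the `f i`, then the vanishing polynomials of the flag are, after division
by their linear coefficients, linearized with coefficients in `A`. -/
theorem C_inv_linCoeff_mul_mem_linearized [Finite F] {A : Subalgebra F (K F V)}
    (hA : ∀ i, f b i ∈ A) {n : ℕ} (hn : n ≤ r) :
    C (linCoeff b n)⁻¹ * vanishingPoly (vecL F V) (flag b n) ∈ linearized A := by
  induction n with
  | zero =>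
    rw [flag_zero, vanishingPoly_bot, linCoeff_zero, inv_one, C_1, one_mul]
    exact X_mem_linearized
  | succ n ih =>
    have ih := ih (by omega)
    have hs := linCoeff_succ b ⟨n, hn⟩
    have hv := vanishingPoly_flag_succ b ⟨n, hn⟩
    have hf := f_mul_g b ⟨n, hn⟩
    have hg0 := algebraMap_g_ne_zero b ⟨n, hn⟩
    have hl0 := linCoeff_ne_zero b (n := n) (by omega)
    dsimp only at hs hv hf
    rw [hs, hv]
    set P := vanishingPoly (vecL F V) (flag b n)
    set c := algebraMap (S F V) (K F V) (g b ⟨n, hn⟩)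
    have hq : Nat.card F = Nat.card F - 1 + 1 := by
      have := Finite.one_lt_card (α := F)
      omega
    have key : C (-c ^ (Nat.card F - 1) * linCoeff b n)⁻¹ *
        (P ^ Nat.card F - C (c ^ (Nat.card F - 1)) * P) = C (linCoeff b n)⁻¹ * P -
          C (f b ⟨n, hn⟩ ^ (Nat.card F - 1)) * (C (linCoeff b n)⁻¹ * P) ^ Nat.card F := by
      have h1 : (-c ^ (Nat.card F - 1) * linCoeff b n)⁻¹ * c ^ (Nat.card F - 1) =
          -(linCoeff b n)⁻¹ := by
        field_simp
      have h2 : (-c ^ (Nat.card F - 1) * linCoeff b n)⁻¹ =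
          -(f b ⟨n, hn⟩ ^ (Nat.card F - 1) * (linCoeff b n)⁻¹ ^ Nat.card F) := by
        rw [eq_div_of_mul_eq hg0 hf, hq, Nat.add_sub_cancel, div_pow, pow_succ, inv_pow]
        field_simp
      rw [mul_sub, ← mul_assoc, ← C_mul, h1, h2, mul_pow]
      simp only [C_neg, C_mul, C_pow]
      ring
    rw [key]
    exact sub_mem ih (C_mul_mem_linearized (pow_mem (hA _) _) (pow_mem_linearized ih))

end Flag

/-! ### Integrality of vectors and their reciprocals -/

section Integrality

variable {F : Type*} [Field F] {V : Type*} [AddCommGroup V] [Module F V] [Finite V]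
  {A : Subalgebra F (K F V)}

theorem isIntegral_vecL (hA : ∀ n, (vanishingPoly (vecL F V) ⊤).coeff n ∈ A) (v : V) :
    IsIntegral A (vecL F V v) := by
  have hl : vanishingPoly (vecL F V) ⊤ ∈ lifts (algebraMap A (K F V)) := by
    rw [lifts_iff_coeff_lifts]
    exact fun n => ⟨⟨_, hA n⟩, rfl⟩
  obtain ⟨p, hp, -, hm⟩ := lifts_and_natDegree_eq_and_monic hl (vanishingPoly_monic _ _)
  refine ⟨p, hm, ?_⟩
  rw [eval₂_eq_eval_map, hp, eval_vanishingPoly_eq_zero]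
  exact ⟨v, trivial, rfl⟩

/-- The reciprocals of the nonzero vectors are the roots of the reversed polynomial of
`k(T) / (k_0 * T)`, which is monic. -/
theorem isIntegral_inv_vecL (h1 : (vanishingPoly (vecL F V) ⊤).coeff 1 ≠ 0)
    (hA : ∀ n, (vanishingPoly (vecL F V) ⊤).coeff n / (vanishingPoly (vecL F V) ⊤).coeff 1 ∈ A)
    {v : V} (hv : v ≠ 0) : IsIntegral A (vecL F V v)⁻¹ := by
  set P := vanishingPoly (vecL F V) ⊤
  have hv0 : vecL F V v ≠ 0 := vecL_ne_zero hv
  have hP0 : P.coeff 0 = 0 := by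
    rw [coeff_zero_eq_eval_zero, eval_vanishingPoly_eq_zero]
    exact ⟨0, trivial, by simp⟩
  have hPv : P.eval (vecL F V v) = 0 := by
    rw [eval_vanishingPoly_eq_zero]
    exact ⟨v, trivial, rfl⟩
  obtain ⟨p, hp⟩ : ∃ p : A[X], p.map (algebraMap A (K F V)) = C (P.coeff 1)⁻¹ * P.divX := by
    rw [← mem_lifts, lifts_iff_coeff_lifts]
    intro n
    refine ⟨⟨_, hA (n + 1)⟩, ?_⟩
    rw [coeff_C_mul, coeff_divX]
    exact div_eq_inv_mul _ _
  have hp0 : p.coeff 0 = 1 := by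
    apply Subtype.val_injective
    have := congrArg (fun Q => coeff Q 0) hp
    rw [coeff_map, coeff_C_mul, coeff_divX, zero_add, inv_mul_cancel₀ h1] at this
    exact this
  have hpv : eval₂ (algebraMap A (K F V)) (vecL F V v) p = 0 := by
    rw [eval₂_eq_eval_map, hp, eval_mul]
    have h := congrArg (eval (vecL F V v)) (divX_mul_X_add P)
    rw [hP0, C_0, add_zero, eval_mul_X, hPv] at h
    rw [(mul_eq_zero.1 h).resolve_right hv0, mul_zero]
  refine ⟨p.reverse, ?_, ?_⟩
  · rw [Monic, reverse_leadingCoeff, trailingCoeff, natTrailingDegree_eq_zero.2, hp0]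
    right
    rw [hp0]
    exact one_ne_zero
  · have := invertibleOfNonzero hv0
    rw [← invOf_eq_inv, eval₂_reverse_eq_zero_iff]
    exact hpv

theorem isIntegral_algebraMap_S (hA : ∀ n, (vanishingPoly (vecL F V) ⊤).coeff n ∈ A) (y : S F V) :
    IsIntegral A (algebraMap (S F V) (K F V) y) := by
  induction y using SymmetricAlgebra.induction with
  | algebraMap c =>
    rw [← IsScalarTower.algebraMap_apply, IsScalarTower.algebraMap_apply F A (K F V)]
    exact isIntegral_algebraMap
  | ι v => exact isIntegral_vecL hA v
  | mul a b ha hb => rw [map_mul]; exact ha.mul hb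
  | add a b ha hb => rw [map_add]; exact ha.add hb

theorem isIntegral_of_mem_R (h1 : (vanishingPoly (vecL F V) ⊤).coeff 1 ≠ 0)
    (hA : ∀ n, (vanishingPoly (vecL F V) ⊤).coeff n / (vanishingPoly (vecL F V) ⊤).coeff 1 ∈ A)
    {y : K F V} (hy : y ∈ R F V) : IsIntegral A y := by
  induction hy using Algebra.adjoin_induction with
  | mem x hx =>
    obtain ⟨v, hv, rfl⟩ := hx
    exact isIntegral_inv_vecL h1 hA hv
  | algebraMap c =>
    rw [IsScalarTower.algebraMap_apply F A (K F V)]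
    exact isIntegral_algebraMap
  | add a b _ _ ha hb => exact ha.add hb
  | mul a b _ _ ha hb => exact ha.mul hb

end Integrality

/-! ### The criterion for the invariants of the two rings -/

section Invariants

variable {F : Type*} [Field F] {V : Type*} [AddCommGroup V] [Module F V]

theorem mem_R_of_mem_gradeR {n : ℤ} {x : K F V} (hx : x ∈ gradeR F V n) : x ∈ R F V := by
  rw [gradeR] at hx
  split_ifs at hx
  · have hle : Submodule.span F (recips F V) ≤ Subalgebra.toSubmodule (R F V) :=
      Submodule.span_le.2 Algebra.subset_adjoin
    exact Submodule.pow_induction_on_left _ (C := (· ∈ R F V)) (R F V).algebraMap_mem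
      (fun _ _ => add_mem) (fun m hm _ hx => mul_mem (hle hm) hx) hx
  · rw [Submodule.mem_bot] at hx
    rw [hx]
    exact zero_mem _

variable [Finite V] [Module.Finite F V] {r : ℕ} {H : Subgroup (V ≃ₗ[F] V)} {d : Fin r → ℤ}

/-- The criterion for `S_V`: homogeneous `H`-invariants `x` in `S_V`, as many as `dim V`, generate
the ring of `H`-invariants if they generate the coefficients of `k(T)` and only `H` fixes them. -/
theorem isPolynomialOn_invS (hV : Module.finrank F V = r) {x : Fin r → S F V}
    (hd : ∀ i, x i ∈ gradeS F V (d i))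
    (hx : ∀ γ ∈ H, ∀ i, actS γ (x i) = x i)
    (hA : ∀ n, (vanishingPoly (vecL F V) ⊤).coeff n ∈
      Algebra.adjoin F (Set.range fun i => algebraMap (S F V) (K F V) (x i)))
    (hH : ∀ γ : V ≃ₗ[F] V, (∀ i, actS γ (x i) = x i) → γ ∈ H) :
    IsPolynomialOn (invS H) (gradeS F V) x d := by
  have hcrit := algebraicIndependent_and_mem_adjoin hV (H := H)
    (fun n => IntermediateField.algebra_adjoin_le_adjoin F _ (hA n)) fun γ hγ => hH γ fun i =>
      algebraMap_S_K_injective (by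
        rw [← actK_algebraMap]
        exact hγ _ (IntermediateField.subset_adjoin F _ ⟨i, rfl⟩))
  have hadj : Algebra.adjoin F (Set.range fun i => algebraMap (S F V) (K F V) (x i)) =
      (Algebra.adjoin F (Set.range x)).map (IsScalarTower.toAlgHom F (S F V) (K F V)) := by
    rw [AlgHom.map_adjoin, ← Set.range_comp]
    rfl
  refine ⟨le_antisymm ?_ ?_, ?_, hd⟩
  · intro y hy
    have h := hcrit.2 (algebraMap _ _ y) (fun γ hγ => by rw [actK_algebraMap, hy γ hγ])
      (isIntegral_algebraMap_S hA y)
    rw [hadj] at h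
    obtain ⟨z, hz, hzy⟩ := h
    rwa [← algebraMap_S_K_injective hzy]
  · rw [Algebra.adjoin_le_iff]
    rintro _ ⟨i, rfl⟩ γ hγ
    exact hx γ hγ i
  · exact AlgebraicIndependent.of_comp (IsScalarTower.toAlgHom F (S F V) (K F V)) hcrit.1

/-- The criterion for `R_V`. By contrast to `S_V`, integrality requires that the elements `x`
generate the coefficients of `k(T) / k_0`, whereas `k_0` need only lie in the field generated. -/
theorem isPolynomialOn_invR (hV : Module.finrank F V = r) {x : Fin r → K F V}
    (hd : ∀ i, x i ∈ gradeR F V (d i))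
    (hx : ∀ γ ∈ H, ∀ i, actK γ (x i) = x i)
    (h1 : (vanishingPoly (vecL F V) ⊤).coeff 1 ≠ 0)
    (hE : (vanishingPoly (vecL F V) ⊤).coeff 1 ∈ IntermediateField.adjoin F (Set.range x))
    (hA : ∀ n, (vanishingPoly (vecL F V) ⊤).coeff n / (vanishingPoly (vecL F V) ⊤).coeff 1 ∈
      Algebra.adjoin F (Set.range x))
    (hH : ∀ γ : V ≃ₗ[F] V,
      (∀ y ∈ IntermediateField.adjoin F (Set.range x), actK γ y = y) → γ ∈ H) :
    IsPolynomialOn (invR H) (gradeR F V) x d := by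
  have hcrit := algebraicIndependent_and_mem_adjoin hV (H := H) (fun n => by
    rw [← div_mul_cancel₀ ((vanishingPoly (vecL F V) ⊤).coeff n) h1]
    exact mul_mem (IntermediateField.algebra_adjoin_le_adjoin F _ (hA n)) hE) hH
  refine ⟨le_antisymm ?_ ?_, hcrit.1, hd⟩
  · exact fun y hy => hcrit.2 y hy.2 (isIntegral_of_mem_R h1 hA hy.1)
  · rw [Algebra.adjoin_le_iff]
    rintro _ ⟨i, rfl⟩
    exact ⟨mem_R_of_mem_gradeR (hd i), fun γ hγ => hx γ hγ i⟩

end Invariants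

/-! ### Invariants of the unitriangular group -/

section Unitriangular

variable {F : Type*} [Field F] {V : Type*} [AddCommGroup V] [Module F V]
  {r : ℕ} (b : Module.Basis (Fin r) F V)

theorem mem_flag_succ (i : Fin r) : b i ∈ flag b (i + 1) :=
  Submodule.subset_span ⟨i, Nat.lt_succ_self _, rfl⟩

variable {b} in
theorem apply_mem_flag {γ : V →ₗ[F] V} (hγ : ∀ i : Fin r, γ (b i) ∈ flag b (i + 1)) {n : ℕ} {v : V}
    (hv : v ∈ flag b n) : γ v ∈ flag b n := by
  have h : flag b n ≤ (flag b n).comap γ := by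
    rw [flag, Submodule.span_le]
    rintro _ ⟨j, hj, rfl⟩
    exact flag_mono b hj (hγ j)
  exact h hv

variable [Finite V]

variable {b} in
theorem bijective_flag_of_unitriangular {γ : V ≃ₗ[F] V} (hγ : ∀ i : Fin r, γ (b i) - b i ∈ flag b i)
    (i : Fin r) : ∃ e : flag b i → flag b i, Function.Bijective e ∧
      ∀ u : flag b i, γ (b i + u) = b i + (e u : V) := by
  have hmem : ∀ j : Fin r, (γ : V →ₗ[F] V) (b j) ∈ flag b (j + 1) := fun j => by
    have := add_mem (flag_mono b (Nat.le_succ _) (hγ j)) (mem_flag_succ b j)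
    simpa using this
  let e : flag b i → flag b i := fun u =>
    ⟨(γ (b i) - b i) + γ u, add_mem (hγ i) (apply_mem_flag hmem u.2)⟩
  refine ⟨e, Finite.injective_iff_bijective.1 fun u u' h => ?_, fun u => ?_⟩
  · have h : (γ (b i) - b i) + γ u = (γ (b i) - b i) + γ u' := congrArg Subtype.val h
    exact Subtype.ext (γ.injective (add_left_cancel h))
  · simp only [e, map_add]
    abel

variable {b} in
theorem actS_g_of_unitriangular {γ : V ≃ₗ[F] V} (hγ : ∀ i : Fin r, γ (b i) - b i ∈ flag b i)
    (i : Fin r) : actS γ (g b i) = g b i := by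
  have := Fintype.ofFinite (flag b i)
  obtain ⟨e, he, h⟩ := bijective_flag_of_unitriangular hγ i
  rw [g_eq, finprod_eq_prod_of_fintype, map_prod]
  refine Fintype.prod_bijective e he _ _ fun u => ?_
  rw [actS_ι, h]

variable {b} in
theorem actK_f_of_unitriangular {γ : V ≃ₗ[F] V} (hγ : ∀ i : Fin r, γ (b i) - b i ∈ flag b i)
    (i : Fin r) : actK γ (f b i) = f b i := by
  have := Fintype.ofFinite (flag b i)
  obtain ⟨e, he, h⟩ := bijective_flag_of_unitriangular hγ i
  rw [f_eq, finsum_eq_sum_of_fintype, map_sum]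
  refine Fintype.sum_bijective e he _ _ fun u => ?_
  rw [map_inv₀, actK_vec, h]

theorem f_mem_gradeR (i : Fin r) : f b i ∈ gradeR F V (-1) := by
  have := Fintype.ofFinite (flag b i)
  rw [gradeR, if_pos (by norm_num), f_eq, finsum_eq_sum_of_fintype]
  rw [neg_neg, Int.toNat_one, pow_one]
  refine sum_mem fun u _ => Submodule.subset_span ⟨_, fun h => ?_, rfl⟩
  refine basis_notMem_flag b i ?_
  rw [eq_neg_of_add_eq_zero_left h]
  exact neg_mem u.2

variable [Finite F]

variable {b} in
/-- An automorphism fixing all `g i` is unitriangular: the difference of `γ (b i)` and `b i` is a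
root of the additive vanishing polynomial of the `i`-th step of the flag, because that polynomial
is fixed by `γ` and takes the value `g i` at `b i`. -/
theorem unitriangular_of_actS_g {γ : V ≃ₗ[F] V} (hγ : ∀ i, actS γ (g b i) = g b i) (i : Fin r) :
    γ (b i) - b i ∈ flag b i := by
  set P := vanishingPoly (vecL F V) (flag b i)
  have hlin : P ∈ linearized (AlgHom.equalizer (actK γ : K F V →ₐ[F] K F V)
      (AlgHom.id F (K F V))) :=
    vanishingPoly_flag_mem_linearized b (fun j => by
      rw [AlgHom.mem_equalizer]
      exact (actK_algebraMap γ _).trans (congrArg _ (hγ j))) i.2.le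
  have hfix : P.map (actK γ : K F V →+* K F V) = P := by
    ext n
    rw [coeff_map]
    exact coeff_mem_of_mem_linearized hlin n
  have hval : P.eval (vecL F V (γ (b i))) = P.eval (vecL F V (b i)) := by
    have h := eval_map_apply (actK γ : K F V →+* K F V) (p := P) (vecL F V (b i))
    rw [hfix] at h
    rw [← actK_vecL]
    refine h.trans ?_
    rw [← algebraMap_g]
    exact (actK_algebraMap γ _).trans (congrArg _ (hγ i))
  have hsub := aeval_sub_of_mem_linearized hlin (vecL F V (γ (b i))) (vecL F V (b i))
  simp only [coe_aeval_eq_eval] at hsub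
  rw [hval, sub_self, ← map_sub, eval_vanishingPoly_eq_zero] at hsub
  obtain ⟨w, hw, h⟩ := hsub
  rwa [vecL_injective h]

theorem g_mem_gradeS (i : Fin r) : g b i ∈ gradeS F V ((Nat.card F : ℤ) ^ (i : ℕ)) := by
  have := Fintype.ofFinite (flag b i)
  rw [gradeS, if_pos (by positivity), g_eq, finprod_eq_prod_of_fintype]
  have h := prod_mem_submodule_pow (M := LinearMap.range (SymmetricAlgebra.ι F V)) Finset.univ
    (y := fun u : flag b i => SymmetricAlgebra.ι F V (b i + (u : V))) fun u _ => ⟨_, rfl⟩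
  rw [Finset.card_univ, ← Nat.card_eq_fintype_card, natCard_flag b i.2.le] at h
  exact_mod_cast h

theorem isPolynomialOn_invS_unitriangular [Module.Finite F V] (hV : Module.finrank F V = r)
    {U : Subgroup (V ≃ₗ[F] V)} (hU : IsUnitriangularIn U b) :
    IsPolynomialOn (invS U) (gradeS F V) (g b) (fun i => (Nat.card F : ℤ) ^ (i : ℕ)) := by
  refine isPolynomialOn_invS hV (g_mem_gradeS b)
    (fun γ hγ => actS_g_of_unitriangular ((hU γ).1 hγ)) (fun n => ?_)
    fun γ hγ => (hU γ).2 (unitriangular_of_actS_g hγ)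
  rw [← flag_self b]
  exact coeff_mem_of_mem_linearized (vanishingPoly_flag_mem_linearized b
    (A := Algebra.adjoin F (Set.range fun i => algebraMap (S F V) (K F V) (g b i)))
    (fun i => Algebra.subset_adjoin ⟨i, rfl⟩) le_rfl) n

theorem algebraMap_g_mem_of_f_mem {E : IntermediateField F (K F V)} (hE : ∀ i, f b i ∈ E)
    (i : Fin r) : algebraMap (S F V) (K F V) (g b i) ∈ E := by
  have hl : ∀ n ≤ r, linCoeff b n ∈ E := by
    intro n hn
    induction n with
    | zero => rw [linCoeff_zero]; exact one_mem _
    | succ n ih =>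
      have ih := ih (by omega)
      have h := linCoeff_succ b ⟨n, hn⟩
      dsimp only at h
      rw [h, eq_div_of_mul_eq (f_ne_zero b _) ((mul_comm _ _).trans (f_mul_g b ⟨n, hn⟩))]
      exact mul_mem (neg_mem (pow_mem (div_mem ih (hE _)) _)) ih
  rw [eq_div_of_mul_eq (f_ne_zero b _) ((mul_comm _ _).trans (f_mul_g b i))]
  exact div_mem (hl i i.2.le) (hE i)

theorem isPolynomialOn_invR_unitriangular [Module.Finite F V] (hV : Module.finrank F V = r)
    {U : Subgroup (V ≃ₗ[F] V)} (hU : IsUnitriangularIn U b) :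
    IsPolynomialOn (invR U) (gradeR F V) (f b) (fun _ => -1) := by
  have hg : ∀ i, algebraMap (S F V) (K F V) (g b i) ∈
      IntermediateField.adjoin F (Set.range (f b)) :=
    algebraMap_g_mem_of_f_mem b fun i => IntermediateField.subset_adjoin F _ ⟨i, rfl⟩
  have hl : (vanishingPoly (vecL F V) ⊤).coeff 1 = linCoeff b r := by rw [linCoeff, flag_self]
  refine isPolynomialOn_invR hV (f_mem_gradeR b)
    (fun γ hγ => actK_f_of_unitriangular ((hU γ).1 hγ)) ?_ ?_ (fun n => ?_)
    fun γ hγ => (hU γ).2 (unitriangular_of_actS_g fun i => algebraMap_S_K_injective ?_)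
  · rw [hl]
    exact linCoeff_ne_zero b le_rfl
  · rw [hl]
    exact linCoeff_mem b (A := (IntermediateField.adjoin F (Set.range (f b))).toSubalgebra) hg
      le_rfl
  · have h := coeff_mem_of_mem_linearized (C_inv_linCoeff_mul_mem_linearized b
      (A := Algebra.adjoin F (Set.range (f b))) (fun i => Algebra.subset_adjoin ⟨i, rfl⟩) le_rfl) n
    rw [coeff_C_mul, flag_self] at h
    rw [hl, div_eq_inv_mul]
    exact h
  · rw [← actK_algebraMap]
    exact hγ _ (hg i)

end Unitriangular

/-! ### Maximal unipotent subgroups -/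

section Unipotent

variable {F : Type*} [Field F] {V : Type*} [AddCommGroup V] [Module F V]

theorem isUnipotentSubgroup_isPGroup {p : ℕ} [Fact p.Prime] [CharP F p]
    {U : Subgroup (V ≃ₗ[F] V)} (hU : IsUnipotentSubgroup U) : IsPGroup p U := by
  rintro ⟨γ, hγ⟩
  obtain ⟨m, hm⟩ := hU γ hγ
  refine ⟨m, Subtype.ext (LinearEquiv.toLinearMap_injective ?_)⟩
  set N : Module.End F V := (γ : V →ₗ[F] V) - LinearMap.id with hN
  have hγN : (γ : V →ₗ[F] V) = N + 1 := by rw [hN]; exact (sub_add_cancel _ _).symm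
  have hX : ((X + 1 : F[X]) ^ p ^ m) = X ^ p ^ m + 1 := by
    rw [add_pow_char_pow, one_pow]
  have h := congrArg (aeval N) hX
  simp only [map_pow, map_add, aeval_X, map_one] at h
  have h0 : N ^ p ^ m = 0 :=
    pow_eq_zero_of_le (Nat.lt_pow_self (Nat.Prime.one_lt Fact.out)).le hm
  rw [h0, zero_add, ← hγN] at h
  have hpow : ∀ n : ℕ, ((γ ^ n : V ≃ₗ[F] V) : V →ₗ[F] V) = (γ : Module.End F V) ^ n := by
    intro n
    induction n with
    | zero => rfl
    | succ n ih => rw [pow_succ, pow_succ, ← ih]; rfl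
  exact (hpow _).trans h

/-- A unipotent group stabilizing a proper subspace `W` fixes a nonzero vector of `V / W`: it is a
`p`-group acting on a nonzero finite vector space of characteristic `p`. -/
theorem exists_notMem_forall_sub_mem [Finite F] [Finite V] {U : Subgroup (V ≃ₗ[F] V)}
    (hU : IsUnipotentSubgroup U) {W : Submodule F V} (hW : W ≠ ⊤)
    (hUW : ∀ γ ∈ U, ∀ w ∈ W, γ w ∈ W) : ∃ v, v ∉ W ∧ ∀ γ ∈ U, γ v - v ∈ W := by
  obtain ⟨p, hchar⟩ := CharP.exists F
  have hp : Fact p.Prime := ⟨CharP.char_is_prime F p⟩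
  have hpU := isUnipotentSubgroup_isPGroup (p := p) hU
  let : MulAction U (V ⧸ W) :=
    { smul := fun γ => W.mapQ W ((γ : V ≃ₗ[F] V) : V →ₗ[F] V) (hUW γ γ.2)
      one_smul := fun x => by
        obtain ⟨v, rfl⟩ := W.mkQ_surjective x
        rfl
      mul_smul := fun γ δ x => by
        obtain ⟨v, rfl⟩ := W.mkQ_surjective x
        rfl }
  have hsmul : ∀ (γ : U) (v : V), γ • W.mkQ v = W.mkQ ((γ : V ≃ₗ[F] V) v) := fun _ _ => rfl
  have : Finite (V ⧸ W) := Finite.of_surjective _ W.mkQ_surjective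
  have hnt : Nontrivial (V ⧸ W) := Submodule.Quotient.nontrivial_iff.2 hW
  have hdvd : p ∣ Nat.card (V ⧸ W) := by
    have := Fintype.ofFinite F
    obtain ⟨n, -, hn⟩ := FiniteField.card F p
    rw [Module.natCard_eq_pow_finrank (K := F), Nat.card_eq_fintype_card, hn]
    exact dvd_pow (dvd_pow_self p n.ne_zero) (Module.finrank_pos (R := F) (M := V ⧸ W)).ne'
  obtain ⟨x, hx, hx0⟩ := hpU.exists_fixed_point_of_prime_dvd_card_of_fixed_point (V ⧸ W) hdvd
    (a := 0) fun γ => by rw [← map_zero W.mkQ, hsmul, map_zero]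
  obtain ⟨v, rfl⟩ := W.mkQ_surjective x
  refine ⟨v, fun hv => hx0 ?_, fun γ hγ => ?_⟩
  · exact ((Submodule.Quotient.mk_eq_zero W).2 hv).symm
  · have := hx ⟨γ, hγ⟩
    rw [hsmul] at this
    exact (Submodule.Quotient.eq W).1 this

theorem exists_linearIndependent_unitriangular [Finite F] [Finite V]
    {U : Subgroup (V ≃ₗ[F] V)} (hU : IsUnipotentSubgroup U) {n : ℕ}
    (hn : n ≤ Module.finrank F V) : ∃ b : Fin n → V, LinearIndependent F b ∧
      ∀ γ ∈ U, ∀ i, γ (b i) - b i ∈ Submodule.span F (b '' Set.Iio i) := by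
  induction n with
  | zero => exact ⟨Fin.elim0, linearIndependent_empty_type, fun _ _ i => i.elim0⟩
  | succ n ih =>
    obtain ⟨b, hb, hγb⟩ := ih (by omega)
    have hW : Submodule.span F (Set.range b) ≠ ⊤ := by
      intro h
      have h1 := finrank_span_eq_card hb
      rw [h, finrank_top, Fintype.card_fin] at h1
      omega
    have hUW : ∀ γ ∈ U, ∀ w ∈ Submodule.span F (Set.range b),
        γ w ∈ Submodule.span F (Set.range b) := by
      intro γ hγ
      have : Submodule.span F (Set.range b) ≤
          (Submodule.span F (Set.range b)).comap (γ : V →ₗ[F] V) := by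
        rw [Submodule.span_le]
        rintro _ ⟨i, rfl⟩
        have h1 := Submodule.span_mono (Set.image_subset_range b _) (hγb γ hγ i)
        have h2 := add_mem h1 (Submodule.subset_span (R := F) (Set.mem_range_self i))
        rw [sub_add_cancel] at h2
        exact h2
      exact this
    obtain ⟨v, hv, hγv⟩ := exists_notMem_forall_sub_mem hU hW hUW
    refine ⟨Fin.snoc b v, linearIndependent_finSnoc.2 ⟨hb, hv⟩, fun γ hγ i => ?_⟩
    induction i using Fin.lastCases with
    | last =>
      rw [Fin.snoc_last]
      refine Submodule.span_mono ?_ (hγv γ hγ)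
      rintro _ ⟨i, rfl⟩
      exact ⟨i.castSucc, Fin.castSucc_lt_last i, Fin.snoc_castSucc ..⟩
    | cast i =>
      rw [Fin.snoc_castSucc]
      refine Submodule.span_mono ?_ (hγb γ hγ i)
      rintro _ ⟨j, hj, rfl⟩
      exact ⟨j.castSucc, Fin.castSucc_lt_castSucc_iff.2 hj, Fin.snoc_castSucc ..⟩

variable {r : ℕ} {b : Module.Basis (Fin r) F V}

theorem sub_apply_mem_flag {γ : V ≃ₗ[F] V} (hγ : ∀ i : Fin r, γ (b i) - b i ∈ flag b i) {n : ℕ}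
    {v : V} (hv : v ∈ flag b (n + 1)) : γ v - v ∈ flag b n := by
  have h : flag b (n + 1) ≤ (flag b n).comap ((γ : V →ₗ[F] V) - LinearMap.id) := by
    rw [flag, Submodule.span_le]
    rintro _ ⟨j, hj, rfl⟩
    exact flag_mono b (Nat.lt_succ_iff.1 hj) (hγ j)
  exact h hv

theorem isNilpotent_of_unitriangular {γ : V ≃ₗ[F] V}
    (hγ : ∀ i : Fin r, γ (b i) - b i ∈ flag b i) :
    IsNilpotent ((γ : V →ₗ[F] V) - LinearMap.id) := by
  refine ⟨r, ?_⟩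
  set N : Module.End F V := (γ : V →ₗ[F] V) - LinearMap.id
  have h : ∀ n ≤ r, ∀ v, (N ^ n) v ∈ flag b (r - n) := by
    intro n hn v
    induction n with
    | zero => rw [Nat.sub_zero, flag_self]; trivial
    | succ n ih =>
      rw [pow_succ']
      refine sub_apply_mem_flag hγ ?_
      rw [show r - (n + 1) + 1 = r - n by omega]
      exact ih (by omega)
  ext v
  have := h r le_rfl v
  rw [Nat.sub_self, flag_zero, Submodule.mem_bot] at this
  exact this

variable (b) in
/-- The group of automorphisms that are upper triangular with unit diagonal in the basis `b`. -/
def unitriangularSubgroup [Finite V] : Subgroup (V ≃ₗ[F] V) where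
  carrier := {γ | ∀ i : Fin r, γ (b i) - b i ∈ flag b i}
  one_mem' i := by simp
  mul_mem' {γ δ} hγ hδ i := by
    have h : γ (δ (b i)) - b i =
        (γ (δ (b i) - b i) - (δ (b i) - b i)) + (δ (b i) - b i) + (γ (b i) - b i) := by
      rw [map_sub]; abel
    rw [LinearEquiv.mul_apply, h]
    exact add_mem (add_mem (sub_apply_mem_flag hγ (flag_mono b (Nat.le_succ _) (hδ i))) (hδ i))
      (hγ i)
  inv_mem' {γ} hγ i := by
    obtain ⟨e, he, h⟩ := bijective_flag_of_unitriangular hγ i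
    obtain ⟨u, hu⟩ := he.2 0
    have h := h u
    rw [hu, ZeroMemClass.coe_zero, add_zero] at h
    have h2 : γ⁻¹ (b i) = b i + u := γ.symm_apply_eq.2 h.symm
    rw [h2, add_sub_cancel_left]
    exact u.2

theorem mem_unitriangularSubgroup [Finite V] {γ : V ≃ₗ[F] V} :
    γ ∈ unitriangularSubgroup b ↔ ∀ i : Fin r, γ (b i) - b i ∈ flag b i := Iff.rfl

theorem exists_isUnitriangularIn [Finite F] [Finite V] (hV : Module.finrank F V = r)
    {U : Subgroup (V ≃ₗ[F] V)} (hU : Maximal IsUnipotentSubgroup U) :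
    ∃ b : Module.Basis (Fin r) F V, IsUnitriangularIn U b := by
  have := Module.Finite.of_finite (R := F) (M := V)
  obtain ⟨b, hb, hγ⟩ := exists_linearIndependent_unitriangular hU.1 hV.ge
  let b' := basisOfLinearIndependentOfCardEqFinrank' b hb (by rw [Fintype.card_fin, hV])
  have hb' : ⇑b' = b := coe_basisOfLinearIndependentOfCardEqFinrank' ..
  have hle : U ≤ unitriangularSubgroup b' := fun γ h i => by
    rw [← span_image_Iio, hb']
    exact hγ γ h i
  have heq := hU.eq_of_le (fun γ h => isNilpotent_of_unitriangular
    (mem_unitriangularSubgroup.1 h)) hle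
  refine ⟨b', fun γ => ?_⟩
  conv_lhs => rw [heq]
  rfl

end Unipotent

/-! ### Dickson invariants -/

section Dickson

variable {F : Type*} [Field F] {V : Type*} [AddCommGroup V] [Module F V] [Finite V]
  {r : ℕ}

theorem natCard_eq_pow (hV : Module.finrank F V = r) : Nat.card V = Nat.card F ^ r := by
  have := Module.Finite.of_finite (R := F) (M := V)
  rw [Module.natCard_eq_pow_finrank (K := F), hV]

theorem algebraMap_k_zero : algebraMap (S F V) (K F V) (k F V 0) =
    (vanishingPoly (vecL F V) ⊤).coeff 1 := by
  rw [algebraMap_k, pow_zero]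

theorem actK_coeff_vanishingPoly_top (γ : V ≃ₗ[F] V) (n : ℕ) :
    actK γ ((vanishingPoly (vecL F V) ⊤).coeff n) = (vanishingPoly (vecL F V) ⊤).coeff n := by
  have h := map_vanishingPoly_actK γ ⊤ fun _ _ => trivial
  conv_rhs => rw [← h, coeff_map]
  rfl

theorem actS_k (γ : V ≃ₗ[F] V) (i : ℕ) : actS γ (k F V i) = k F V i :=
  algebraMap_S_K_injective (by
    rw [← actK_algebraMap, algebraMap_k, actK_coeff_vanishingPoly_top])

theorem vanishingPoly_top_eq :
    vanishingPoly (vecL F V) ⊤ = X * ∏ᶠ v : {v : V // v ≠ 0}, (X - C (vecL F V v)) := by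
  classical
  have := Fintype.ofFinite V
  have := Fintype.ofFinite (⊤ : Submodule F V)
  rw [vanishingPoly, finprod_eq_prod_of_fintype, finprod_eq_prod_of_fintype,
    ← Fintype.prod_equiv (Submodule.topEquiv (R := F) (M := V)).symm.toEquiv
      (fun v => X - C (vecL F V v)) _ fun w => rfl, Fintype.prod_eq_mul_prod_subtype_ne _ 0]
  simp

theorem coeff_one_vanishingPoly_top :
    (vanishingPoly (vecL F V) ⊤).coeff 1 = ∏ᶠ v : {v : V // v ≠ 0}, -vecL F V v := by
  have := Fintype.ofFinite {v : V // v ≠ 0}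
  rw [vanishingPoly_top_eq, coeff_X_mul, finprod_eq_prod_of_fintype, finprod_eq_prod_of_fintype,
    coeff_zero_eq_eval_zero, eval_prod]
  simp

theorem coeff_natCard_pow_vanishingPoly_top (hV : Module.finrank F V = r) :
    (vanishingPoly (vecL F V) ⊤).coeff (Nat.card F ^ r) = 1 := by
  have h := vanishingPoly_natDegree (vecL F V) ⊤
  rw [Nat.card_congr (Submodule.topEquiv (R := F) (M := V)).toEquiv, natCard_eq_pow hV] at h
  rw [← h]
  exact vanishingPoly_monic _ _

theorem h_eq_div (hV : Module.finrank F V = r) {j : ℕ} (hj : j ≤ r) : h F V j =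
    (vanishingPoly (vecL F V) ⊤).coeff (Nat.card F ^ j) /
      (vanishingPoly (vecL F V) ⊤).coeff 1 := by
  rw [h, algebraMap_k_zero, hV]
  split_ifs with hlt
  · rw [algebraMap_k]
  · rw [le_antisymm hj (not_lt.1 hlt), coeff_natCard_pow_vanishingPoly_top hV]

theorem h_finrank_eq (hV : Module.finrank F V = r) :
    h F V r = ((vanishingPoly (vecL F V) ⊤).coeff 1)⁻¹ := by
  rw [h_eq_div hV le_rfl, coeff_natCard_pow_vanishingPoly_top hV, one_div]

theorem actK_h (hV : Module.finrank F V = r) (γ : V ≃ₗ[F] V) {j : ℕ} (hj : j ≤ r) :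
    actK γ (h F V j) = h F V j := by
  rw [h_eq_div hV hj, map_div₀, actK_coeff_vanishingPoly_top, actK_coeff_vanishingPoly_top]

variable [Finite F]

theorem coeff_one_vanishingPoly_top_ne_zero : (vanishingPoly (vecL F V) ⊤).coeff 1 ≠ 0 := by
  have := Module.Finite.of_finite (R := F) (M := V)
  have h := linCoeff_ne_zero (Module.finBasis F V) le_rfl
  rwa [linCoeff, flag_self] at h

/-- Since `k(T)` is linearized of degree `q ^ r`, a subalgebra contains all its coefficients,
divided by some `c`, once it contains those at `T ^ (q ^ j)` for `j ≤ r`. -/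
theorem coeff_div_mem (hV : Module.finrank F V = r) {A : Subalgebra F (K F V)} {c : K F V}
    (hA : ∀ j ≤ r, (vanishingPoly (vecL F V) ⊤).coeff (Nat.card F ^ j) / c ∈ A) (n : ℕ) :
    (vanishingPoly (vecL F V) ⊤).coeff n / c ∈ A := by
  have := Module.Finite.of_finite (R := F) (M := V)
  by_cases h : ∃ j ≤ r, n = Nat.card F ^ j
  · obtain ⟨j, hj, rfl⟩ := h
    exact hA j hj
  · suffices h0 : (vanishingPoly (vecL F V) ⊤).coeff n = 0 by
      rw [h0, zero_div]
      exact zero_mem _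
    by_cases hn : ∃ j, n = Nat.card F ^ j
    · obtain ⟨j, rfl⟩ := hn
      apply coeff_eq_zero_of_natDegree_lt
      rw [vanishingPoly_natDegree, Nat.card_congr (Submodule.topEquiv (R := F) (M := V)).toEquiv,
        natCard_eq_pow hV]
      refine Nat.pow_lt_pow_right Finite.one_lt_card ?_
      by_contra hj
      exact h ⟨j, not_lt.1 hj, rfl⟩
    · have hlin := vanishingPoly_flag_mem_linearized (Module.finBasis F V) (A := ⊤)
        (fun _ => trivial) le_rfl
      rw [flag_self] at hlin
      exact coeff_eq_zero_of_mem_linearized hlin fun j hj => hn ⟨j, hj⟩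

theorem k_mem_gradeS (hV : Module.finrank F V = r) {j : ℕ} (hj : j ≤ r) :
    k F V j ∈ gradeS F V ((Nat.card F : ℤ) ^ r - (Nat.card F : ℤ) ^ j) := by
  have := Fintype.ofFinite V
  have hle : Nat.card F ^ j ≤ Nat.card F ^ r := Nat.pow_le_pow_right Nat.card_pos hj
  have hd : (Nat.card F : ℤ) ^ r - (Nat.card F : ℤ) ^ j =
      ((Nat.card F ^ r - Nat.card F ^ j : ℕ) : ℤ) := by
    push_cast [hle]
    ring
  have hc : Finset.univ.card (α := V) = Nat.card F ^ r := by
    rw [Finset.card_univ, ← Nat.card_eq_fintype_card, natCard_eq_pow hV]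
  rw [hd, gradeS, if_pos (Int.natCast_nonneg _), Int.toNat_natCast, k, kPoly,
    finprod_eq_prod_of_fintype, ← hc]
  exact coeff_prod_X_sub_C_mem _ (fun v _ => LinearMap.mem_range_self _ v) (by rw [hc]; exact hle)

/-- The coefficients of `k(T) / (k_0 * T)`, the product of all `1 - T / v`, are the elementary
symmetric functions of the reciprocals up to sign. -/
theorem coeff_succ_div_mem (n : ℕ) :
    (vanishingPoly (vecL F V) ⊤).coeff (n + 1) / (vanishingPoly (vecL F V) ⊤).coeff 1 ∈
      Submodule.span F (recips F V) ^ n := by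
  have := Fintype.ofFinite {v : V // v ≠ 0}
  have h : ∏ v : {v : V // v ≠ 0}, (X - C (vecL F V v)) =
      C ((vanishingPoly (vecL F V) ⊤).coeff 1) *
        ∏ v : {v : V // v ≠ 0}, (1 - C (vecL F V v)⁻¹ * X) := by
    rw [coeff_one_vanishingPoly_top, finprod_eq_prod_of_fintype, map_prod,
      ← Finset.prod_mul_distrib]
    refine Finset.prod_congr rfl fun v _ => ?_
    rw [mul_sub, ← mul_assoc, ← C_mul, neg_mul, mul_inv_cancel₀ (vecL_ne_zero v.2)]
    simp only [C_neg, C_1]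
    ring
  have h1 : (vanishingPoly (vecL F V) ⊤).coeff (n + 1) =
      (vanishingPoly (vecL F V) ⊤).coeff 1 *
        (∏ v : {v : V // v ≠ 0}, (1 - C (vecL F V v)⁻¹ * X)).coeff n := by
    rw [← coeff_C_mul, ← h]
    conv_lhs => rw [vanishingPoly_top_eq, coeff_X_mul, finprod_eq_prod_of_fintype]
  rw [h1, mul_div_cancel_left₀ _ (coeff_one_vanishingPoly_top_ne_zero (F := F) (V := V))]
  exact coeff_prod_one_sub_C_mul_X_mem _
    (y := fun v : {v : V // v ≠ 0} => (vecL F V v)⁻¹) (fun v _ =>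
      Submodule.subset_span (show _ ∈ recips F V from ⟨v, v.2, rfl⟩)) n

theorem h_mem_gradeR (hV : Module.finrank F V = r) {j : ℕ} (hj : j ≤ r) :
    h F V j ∈ gradeR F V (1 - (Nat.card F : ℤ) ^ j) := by
  have hpos : 1 ≤ Nat.card F ^ j := Nat.one_le_pow _ _ Nat.card_pos
  have hd : 1 - (Nat.card F : ℤ) ^ j = -((Nat.card F ^ j - 1 : ℕ) : ℤ) := by
    push_cast [hpos]
    ring
  rw [hd, gradeR, if_pos (by omega), neg_neg, Int.toNat_natCast, h_eq_div hV hj]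
  have := coeff_succ_div_mem (F := F) (V := V) (Nat.card F ^ j - 1)
  rwa [Nat.sub_add_cancel hpos] at this

theorem isPolynomialOn_invS_top [Module.Finite F V] (hV : Module.finrank F V = r) :
    IsPolynomialOn (invS (⊤ : Subgroup (V ≃ₗ[F] V))) (gradeS F V) (fun i : Fin r => k F V i)
      (fun i => (Nat.card F : ℤ) ^ r - (Nat.card F : ℤ) ^ (i : ℕ)) := by
  refine isPolynomialOn_invS hV (fun i => k_mem_gradeS hV i.2.le) (fun γ _ i => actS_k γ i)
    (fun n => ?_) fun _ _ => trivial
  rw [← div_one ((vanishingPoly (vecL F V) ⊤).coeff n)]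
  refine coeff_div_mem hV (fun j hj => ?_) n
  rw [div_one]
  rcases hj.lt_or_eq with hj | rfl
  · exact Algebra.subset_adjoin ⟨⟨j, hj⟩, algebraMap_k j⟩
  · rw [coeff_natCard_pow_vanishingPoly_top hV]
    exact one_mem _

theorem isPolynomialOn_invR_top [Module.Finite F V] (hr : 1 ≤ r) (hV : Module.finrank F V = r) :
    IsPolynomialOn (invR (⊤ : Subgroup (V ≃ₗ[F] V))) (gradeR F V)
      (fun i : Fin r => h F V (i + 1)) (fun i => 1 - (Nat.card F : ℤ) ^ ((i : ℕ) + 1)) := by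
  refine isPolynomialOn_invR hV (fun i => h_mem_gradeR hV i.2) (fun γ _ i => actK_h hV γ i.2)
    coeff_one_vanishingPoly_top_ne_zero ?_ (coeff_div_mem hV fun j hj => ?_) fun _ _ => trivial
  · rw [← inv_inv ((vanishingPoly (vecL F V) ⊤).coeff 1), ← h_finrank_eq hV]
    refine inv_mem (IntermediateField.subset_adjoin F _ ⟨⟨r - 1, by omega⟩, ?_⟩)
    dsimp only
    rw [Nat.sub_add_cancel hr]
  · rw [← h_eq_div hV hj]
    rcases j with _ | j
    · rw [h_eq_div hV hj, pow_zero, div_self coeff_one_vanishingPoly_top_ne_zero]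
      exact one_mem _
    · exact Algebra.subset_adjoin ⟨⟨j, hj⟩, rfl⟩

end Dickson

/-! ### The product over the lines of `V` -/

section Lines

variable {F : Type*} [Field F] {V : Type*} [AddCommGroup V] [Module F V] {r : ℕ}

theorem mk_eq_of_isLineSection {s : Projectivization F V → V} (hs : IsLineSection s)
    (l : Projectivization F V) : Projectivization.mk F (s l) (hs l).1 = l := by
  have h := (hs l).2
  rw [Projectivization.submodule_eq, Submodule.mem_span_singleton] at h
  conv_rhs => rw [← l.mk_rep]
  rw [Projectivization.mk_eq_mk_iff']
  exact h

theorem bijective_units_smul_lineSection {s : Projectivization F V → V} (hs : IsLineSection s) :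
    Function.Bijective fun x : Projectivization F V × Fˣ =>
      (⟨x.2 • s x.1, smul_ne_zero x.2.ne_zero (hs x.1).1⟩ : {v : V // v ≠ 0}) := by
  constructor
  · rintro ⟨l, a⟩ ⟨l', a'⟩ h
    have h : a • s l = a' • s l' := congrArg Subtype.val h
    have hl : l = l' := by
      rw [← mk_eq_of_isLineSection hs l, ← mk_eq_of_isLineSection hs l',
        Projectivization.mk_eq_mk_iff]
      exact ⟨a⁻¹ * a', by rw [mul_smul, ← h, inv_smul_smul]⟩
    subst hl
    rw [Units.smul_def, Units.smul_def] at h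
    exact Prod.ext rfl (Units.ext (smul_left_injective F (hs l).1 h))
  · rintro ⟨v, hv⟩
    have h := mk_eq_of_isLineSection hs (Projectivization.mk F v hv)
    rw [Projectivization.mk_eq_mk_iff] at h
    obtain ⟨a, ha⟩ := h
    refine ⟨(Projectivization.mk F v hv, a⁻¹), Subtype.ext ?_⟩
    rw [inv_smul_eq_iff]
    exact ha.symm

variable [Finite V]

theorem algebraMap_k' (s : Projectivization F V → V) :
    algebraMap (S F V) (K F V) (k' s) = ∏ᶠ l, vecL F V (s l) := by
  have := Fintype.ofFinite (Projectivization F V)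
  rw [k', finprod_eq_prod_of_fintype, finprod_eq_prod_of_fintype, map_prod]
  rfl

theorem algebraMap_k'_ne_zero {s : Projectivization F V → V} (hs : IsLineSection s) :
    algebraMap (S F V) (K F V) (k' s) ≠ 0 := by
  have := Fintype.ofFinite (Projectivization F V)
  rw [algebraMap_k', finprod_eq_prod_of_fintype]
  exact Finset.prod_ne_zero_iff.2 fun l _ => vecL_ne_zero (hs l).1

theorem k'_ne_zero {s : Projectivization F V → V} (hs : IsLineSection s) : k' s ≠ 0 := by
  intro h
  have := algebraMap_k'_ne_zero hs
  rw [h, map_zero] at this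
  exact this rfl

variable [Finite F]

theorem exists_coeff_one_eq_smul_k' {s : Projectivization F V → V} (hs : IsLineSection s) :
    ∃ c : F, c ≠ 0 ∧ (vanishingPoly (vecL F V) ⊤).coeff 1 =
      c • algebraMap (S F V) (K F V) (k' s) ^ (Nat.card F - 1) := by
  classical
  have := Fintype.ofFinite F
  have := Fintype.ofFinite (Projectivization F V)
  have := Fintype.ofFinite {v : V // v ≠ 0}
  refine ⟨∏ _l : Projectivization F V, ∏ a : Fˣ, -(a : F),
    Finset.prod_ne_zero_iff.2 fun _ _ => Finset.prod_ne_zero_iff.2 fun a _ =>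
      neg_ne_zero.2 a.ne_zero, ?_⟩
  rw [coeff_one_vanishingPoly_top, finprod_eq_prod_of_fintype,
    ← Fintype.prod_bijective _ (bijective_units_smul_lineSection hs) _ _ (fun _ => rfl),
    Fintype.prod_prod_type, algebraMap_k', finprod_eq_prod_of_fintype, Algebra.smul_def, map_prod,
    ← Finset.prod_pow, ← Finset.prod_mul_distrib]
  refine Finset.prod_congr rfl fun l _ => ?_
  have h : ∀ a : Fˣ, -vecL F V (a • s l) = algebraMap F (K F V) (-(a : F)) * vecL F V (s l) := by
    intro a
    rw [Units.smul_def, map_smul, Algebra.smul_def, map_neg, neg_mul]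
  simp only [h]
  rw [Finset.prod_mul_distrib, map_prod, Finset.prod_const, Finset.card_univ, Fintype.card_units,
    Nat.card_eq_fintype_card]

/-- The number of lines; the division of integers is exact. -/
theorem natCard_projectivization (hV : Module.finrank F V = r) :
    (Nat.card (Projectivization F V) : ℤ) =
      ((Nat.card F : ℤ) ^ r - 1) / ((Nat.card F : ℤ) - 1) := by
  have hq : 1 < Nat.card F := Finite.one_lt_card
  have h := Projectivization.card' F V
  rw [natCard_eq_pow hV] at h
  have h : (Nat.card F : ℤ) ^ r =
      Nat.card (Projectivization F V) * ((Nat.card F : ℤ) - 1) + 1 := by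
    have h2 := congrArg (Nat.cast : ℕ → ℤ) h
    push_cast [hq.le] at h2
    exact h2
  rw [h, add_sub_cancel_right, Int.mul_ediv_cancel _ (by omega)]

theorem k'_mem_gradeS (hV : Module.finrank F V = r) (s : Projectivization F V → V) :
    k' s ∈ gradeS F V (((Nat.card F : ℤ) ^ r - 1) / ((Nat.card F : ℤ) - 1)) := by
  have := Fintype.ofFinite (Projectivization F V)
  rw [← natCard_projectivization hV, gradeS, if_pos (Int.natCast_nonneg _), Int.toNat_natCast, k',
    finprod_eq_prod_of_fintype, Nat.card_eq_fintype_card]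
  exact prod_mem_submodule_pow _ fun l _ => LinearMap.mem_range_self _ (s l)

theorem h'_mem_gradeR (hV : Module.finrank F V = r) {s : Projectivization F V → V}
    (hs : IsLineSection s) :
    h' s ∈ gradeR F V ((1 - (Nat.card F : ℤ) ^ r) / ((Nat.card F : ℤ) - 1)) := by
  have := Fintype.ofFinite (Projectivization F V)
  have hd : (1 - (Nat.card F : ℤ) ^ r) / ((Nat.card F : ℤ) - 1) =
      -(Nat.card (Projectivization F V) : ℤ) := by
    have hdvd : (Nat.card F : ℤ) - 1 ∣ (Nat.card F : ℤ) ^ r - 1 := by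
      simpa using sub_dvd_pow_sub_pow (Nat.card F : ℤ) 1 r
    rw [natCard_projectivization hV, ← Int.neg_ediv_of_dvd hdvd, neg_sub]
  rw [hd, gradeR, if_pos (by omega), neg_neg, Int.toNat_natCast, h', algebraMap_k',
    finprod_eq_prod_of_fintype, ← Finset.prod_inv_distrib, Nat.card_eq_fintype_card]
  exact prod_mem_submodule_pow _ fun l _ =>
    Submodule.subset_span (show _ ∈ recips F V from ⟨s l, (hs l).1, rfl⟩)

end Lines

/-! ### The character through which the linear group acts on the product over the lines -/

section Determinant

variable {F : Type*} [Field F] {V : Type*} [AddCommGroup V] [Module F V]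

theorem isIntegrallyClosed_S : IsIntegrallyClosed (S F V) :=
  IsIntegrallyClosed.of_equiv
    (SymmetricAlgebra.equivMvPolynomial (Module.Basis.ofVectorSpace F V)).symm.toRingEquiv

theorem exists_eq_algebraMap_of_isUnit {x : S F V} (hx : IsUnit x) :
    ∃ c : F, c ≠ 0 ∧ x = algebraMap F (S F V) c := by
  let e := SymmetricAlgebra.equivMvPolynomial (Module.Basis.ofVectorSpace F V)
  obtain ⟨c, hc, h⟩ := MvPolynomial.isUnit_iff_eq_C_of_isReduced.1 (hx.map e)
  refine ⟨c, hc.ne_zero, e.injective ?_⟩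
  rw [h, AlgEquiv.commutes]
  rfl

theorem actS_mul (γ δ : V ≃ₗ[F] V) (x : S F V) : actS (γ * δ) x = actS γ (actS δ x) := by
  have h : (actS (γ * δ) : S F V →ₐ[F] S F V) =
      (actS γ : S F V →ₐ[F] S F V).comp (actS δ : S F V →ₐ[F] S F V) := by
    refine SymmetricAlgebra.algHom_ext ?_
    ext v
    simp [actS_ι]
  exact DFunLike.congr_fun h x

theorem actS_one (x : S F V) : actS (1 : V ≃ₗ[F] V) x = x := by
  have h : (actS (1 : V ≃ₗ[F] V) : S F V →ₐ[F] S F V) = AlgHom.id F _ := by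
    refine SymmetricAlgebra.algHom_ext ?_
    ext v
    simp [actS_ι]
  exact DFunLike.congr_fun h x

variable {r : ℕ} (b : Module.Basis (Fin r) F V)

theorem toLin_pow_eq {γ : V ≃ₗ[F] V} {M : Matrix (Fin r) (Fin r) F}
    (hγ : (γ : V →ₗ[F] V) = Matrix.toLin b b M) (n : ℕ) :
    ((γ ^ n : V ≃ₗ[F] V) : V →ₗ[F] V) = Matrix.toLin b b (M ^ n) := by
  induction n with
  | zero => rw [pow_zero, pow_zero, Matrix.toLin_one]; rfl
  | succ n ih => rw [pow_succ, pow_succ, Matrix.toLin_mul b b b, ← ih, ← hγ]; rfl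

variable [Finite F] [Finite V] {s : Projectivization F V → V}

theorem natCard_sub_one_ne_zero : Nat.card F - 1 ≠ 0 := by
  have := Finite.one_lt_card (α := F)
  omega

theorem linCoeff_eq_prod : linCoeff b r =
    (-1) ^ r * algebraMap (S F V) (K F V) (∏ i, g b i) ^ (Nat.card F - 1) := by
  let G : ℕ → S F V := fun n => if hn : n < r then g b ⟨n, hn⟩ else 1
  have h : ∀ n ≤ r, linCoeff b n =
      (-1) ^ n * algebraMap (S F V) (K F V) (∏ i ∈ Finset.range n, G i) ^ (Nat.card F - 1) := by
    intro n hn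
    induction n with
    | zero => simp [linCoeff_zero]
    | succ n ih =>
      have hs := linCoeff_succ b ⟨n, hn⟩
      dsimp only at hs
      have hG : G n = g b ⟨n, hn⟩ := dif_pos hn
      rw [hs, ih (by omega), Finset.prod_range_succ, hG, map_mul, mul_pow, pow_succ]
      ring
  rw [h r le_rfl, Finset.prod_range]
  congr 4
  funext i
  exact dif_pos i.2

/-- In any basis, the product of the `g i` is a product over the lines of `V`. Indeed the
`(q - 1)`-th powers of the two products both agree with `k_0` up to constants, and the ring `S_V`
is integrally closed with only constants as units. -/
theorem exists_prod_g_eq_smul_k' (hs : IsLineSection s) :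
    ∃ c : F, c ≠ 0 ∧ ∏ i, g b i = c • k' s := by
  obtain ⟨c, hc, h⟩ := exists_coeff_one_eq_smul_k' hs
  have hl := linCoeff_eq_prod b
  rw [linCoeff, flag_self, h] at hl
  have hl : c • k' s ^ (Nat.card F - 1) = (-1) ^ r * (∏ i, g b i) ^ (Nat.card F - 1) := by
    apply algebraMap_S_K_injective
    rw [map_mul, map_pow, map_pow, map_neg, map_one, ← hl,
      ← IsScalarTower.toAlgHom_apply F (S F V) (K F V), map_smul, map_pow]
    rfl
  have hu : IsUnit (algebraMap F (S F V) c) := hc.isUnit.map _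
  have hu2 : IsUnit ((-1 : S F V) ^ r) := isUnit_one.neg.pow r
  have := isIntegrallyClosed_S (F := F) (V := V)
  have h1 : k' s ∣ ∏ i, g b i := by
    rw [← IsIntegrallyClosed.pow_dvd_pow_iff (natCard_sub_one_ne_zero (F := F)),
      ← hu2.dvd_mul_left, ← hl, Algebra.smul_def]
    exact dvd_mul_left _ _
  have h2 : ∏ i, g b i ∣ k' s := by
    rw [← IsIntegrallyClosed.pow_dvd_pow_iff (natCard_sub_one_ne_zero (F := F)),
      ← hu.dvd_mul_left, ← Algebra.smul_def, hl]
    exact dvd_mul_left _ _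
  obtain ⟨u, hu⟩ := associated_of_dvd_dvd h1 h2
  obtain ⟨a, ha, h⟩ := exists_eq_algebraMap_of_isUnit u.isUnit
  exact ⟨a, ha, by rw [← hu, h, Algebra.smul_def, mul_comm]⟩

/-- As `k_0` is invariant, `γ k'` and `k'` have the same `(q - 1)`-th power. They differ by a
constant because the field with `q` elements contains all `(q - 1)`-th roots of unity. -/
theorem exists_actS_k'_eq_smul (hs : IsLineSection s) (γ : V ≃ₗ[F] V) :
    ∃ a : F, actS γ (k' s) = a • k' s := by
  have := Fintype.ofFinite F
  obtain ⟨c, hc, h⟩ := exists_coeff_one_eq_smul_k' hs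
  set w := algebraMap (S F V) (K F V) (k' s) with hw
  have hw0 : w ≠ 0 := algebraMap_k'_ne_zero hs
  have hpow : actK γ w ^ (Nat.card F - 1) = w ^ (Nat.card F - 1) := by
    have h2 := congrArg (actK γ) h
    rw [actK_coeff_vanishingPoly_top, map_smul, map_pow, h] at h2
    exact (smul_right_injective _ hc h2).symm
  have hq : Nat.card F = Nat.card F - 1 + 1 := by
    have := Finite.one_lt_card (α := F)
    omega
  have hprod := finprod_sub_smul (F := F) (actK γ w) hw0.isUnit
  rw [hq, pow_succ, Nat.add_sub_cancel, hpow, sub_self, finprod_eq_prod_of_fintype,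
    Finset.prod_eq_zero_iff] at hprod
  obtain ⟨a, -, ha⟩ := hprod
  refine ⟨a, algebraMap_S_K_injective ?_⟩
  rw [← actK_algebraMap, ← hw, sub_eq_zero.1 ha,
    ← IsScalarTower.toAlgHom_apply F (S F V) (K F V), map_smul]
  rfl

variable {b} in
theorem actS_g_of_diagonal {γ : V ≃ₗ[F] V} {D : Fin r → F} (hD : ∀ i, D i ≠ 0)
    (hγ : ∀ i, γ (b i) = D i • b i) (i : Fin r) : actS γ (g b i) = D i • g b i := by
  have := Fintype.ofFinite (flag b i)
  have hmem : ∀ j : Fin r, (γ : V →ₗ[F] V) (b j) ∈ flag b (j + 1) := fun j => by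
    rw [LinearEquiv.coe_coe, hγ]
    exact Submodule.smul_mem _ _ (mem_flag_succ b j)
  let e : flag b i → flag b i := fun u =>
    ⟨(D i)⁻¹ • γ u, Submodule.smul_mem _ _ (apply_mem_flag hmem u.2)⟩
  have he : Function.Bijective e := Finite.injective_iff_bijective.1 fun u u' h => by
    have h : (D i)⁻¹ • γ u = (D i)⁻¹ • γ u' := congrArg Subtype.val h
    exact Subtype.ext (γ.injective (smul_right_injective V (inv_ne_zero (hD i)) h))
  have hDq : D i ^ Nat.card (flag b i) = D i := by
    have := Fintype.ofFinite F
    rw [natCard_flag b i.2.le, Nat.card_eq_fintype_card, FiniteField.pow_card_pow]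
  conv_rhs => rw [← hDq]
  rw [g_eq, finprod_eq_prod_of_fintype, map_prod,
    ← Fintype.prod_bijective e he (fun u => SymmetricAlgebra.ι F V (b i + (e u : V)))
      (fun u => SymmetricAlgebra.ι F V (b i + (u : V))) (fun _ => rfl), Algebra.smul_def,
    map_pow, Nat.card_eq_fintype_card, ← Finset.card_univ, ← Finset.prod_const,
    ← Finset.prod_mul_distrib]
  refine Finset.prod_congr rfl fun u _ => ?_
  rw [actS_ι, ← Algebra.smul_def, ← map_smul, smul_add, smul_inv_smul₀ (hD i), map_add, hγ]

theorem transvection_pow_natCard {n : Type*} [Fintype n] [DecidableEq n]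
    (t : Matrix.TransvectionStruct n F) : t.toMatrix ^ Nat.card F = 1 := by
  have h : ∀ m : ℕ, t.toMatrix ^ m = Matrix.transvection t.i t.j (m * t.c) := by
    intro m
    induction m with
    | zero => simp
    | succ m ih =>
      rw [pow_succ, ih, Matrix.TransvectionStruct.toMatrix,
        Matrix.transvection_mul_transvection_same _ _ t.hij]
      push_cast
      ring_nf
  have := Fintype.ofFinite F
  rw [h, Nat.card_eq_fintype_card, FiniteField.cast_card_eq_zero, zero_mul,
    Matrix.transvection_zero]

/-- The product over the lines is multiplied by the determinant. By the factorization of invertible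
matrices it suffices to check this for diagonal matrices, where the product can be replaced by that
of the `g i`, and for transvections, whose order divides `q` and is thus prime to that of `Fˣ`. -/
theorem actS_k' (hs : IsLineSection s) (γ : V ≃ₗ[F] V) :
    actS γ (k' s) = LinearMap.det (γ : V →ₗ[F] V) • k' s := by
  have := Module.Finite.of_finite (R := F) (M := V)
  let b := Module.finBasis F V
  have key : ∀ M : Matrix _ _ F, M.det ≠ 0 → ∀ γ : V ≃ₗ[F] V,
      (γ : V →ₗ[F] V) = Matrix.toLin b b M → actS γ (k' s) = M.det • k' s := by
    intro M hM
    refine Matrix.diagonal_transvection_induction_of_det_ne_zero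
      (fun M => ∀ γ : V ≃ₗ[F] V,
        (γ : V →ₗ[F] V) = Matrix.toLin b b M → actS γ (k' s) = M.det • k' s) M hM ?_ ?_ ?_
    · intro D hD γ hγ
      rw [Matrix.det_diagonal] at hD ⊢
      have hD0 : ∀ i, D i ≠ 0 := fun i => Finset.prod_ne_zero_iff.1 hD i (Finset.mem_univ i)
      have hγb : ∀ i, γ (b i) = D i • b i := by
        intro i
        rw [← LinearEquiv.coe_coe, hγ, Matrix.toLin_self]
        simp [Matrix.diagonal_apply]
      obtain ⟨c, hc, h⟩ := exists_prod_g_eq_smul_k' b hs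
      have h2 := congrArg (actS γ) h
      rw [map_prod, map_smul] at h2
      simp only [actS_g_of_diagonal hD0 hγb] at h2
      rw [Finset.prod_smul, h, smul_comm] at h2
      exact (smul_right_injective _ hc h2).symm
    · intro t γ hγ
      obtain ⟨a, ha⟩ := exists_actS_k'_eq_smul hs γ
      have hpow : ∀ n : ℕ, actS (γ ^ n) (k' s) = a ^ n • k' s := by
        intro n
        induction n with
        | zero => rw [pow_zero, pow_zero, actS_one, one_smul]
        | succ n ih =>
          rw [pow_succ, actS_mul, ha, map_smul, ih, smul_smul, pow_succ, mul_comm]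
      have hone : γ ^ Nat.card F = 1 := by
        apply LinearEquiv.toLinearMap_injective
        rw [toLin_pow_eq b hγ, transvection_pow_natCard, Matrix.toLin_one]
        rfl
      have ha1 : a = 1 := by
        have h := hpow (Nat.card F)
        have := Fintype.ofFinite F
        rw [hone, actS_one, Nat.card_eq_fintype_card, FiniteField.pow_card] at h
        refine smul_left_injective F (k'_ne_zero hs) ?_
        dsimp only
        rw [← h, one_smul]
      rw [ha, ha1, Matrix.TransvectionStruct.det]
    · intro A B hA hB ihA ihB γ hγ
      have hA' : LinearMap.det (Matrix.toLin b b A) ≠ 0 := by rwa [LinearMap.det_toLin]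
      have hB' : LinearMap.det (Matrix.toLin b b B) ≠ 0 := by rwa [LinearMap.det_toLin]
      have hγ' : γ = LinearMap.equivOfDetNeZero _ hA' * LinearMap.equivOfDetNeZero _ hB' := by
        apply LinearEquiv.toLinearMap_injective
        rw [hγ, Matrix.toLin_mul b b b]
        rfl
      rw [hγ', actS_mul, ihB _ rfl, map_smul, ihA _ rfl, smul_smul, Matrix.det_mul, mul_comm]
  have h := key (LinearMap.toMatrix b b (γ : V →ₗ[F] V)) (by
    rw [LinearMap.det_toMatrix]
    exact (LinearEquiv.isUnit_det' γ).ne_zero) γ (by rw [Matrix.toLin_toMatrix])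
  rwa [LinearMap.det_toMatrix] at h

theorem actS_k'_eq_iff (hs : IsLineSection s) (γ : V ≃ₗ[F] V) :
    actS γ (k' s) = k' s ↔ γ ∈ (LinearEquiv.det : (V ≃ₗ[F] V) →* Fˣ).ker := by
  rw [MonoidHom.mem_ker, ← Units.val_inj, LinearEquiv.coe_det, Units.val_one, actS_k' hs]
  refine ⟨fun h => smul_left_injective F (k'_ne_zero hs) ?_, fun h => by rw [h, one_smul]⟩
  dsimp only
  rw [h, one_smul]

end Determinant

/-! ### Invariants of the special linear group -/

section Special

variable {F : Type*} [Field F] [Finite F] {V : Type*} [AddCommGroup V] [Module F V] [Finite V]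
  [Module.Finite F V] {r : ℕ} {s : Projectivization F V → V}

theorem isPolynomialOn_invS_det (hV : Module.finrank F V = r) (hr : 1 ≤ r)
    (hs : IsLineSection s) :
    IsPolynomialOn (invS (LinearEquiv.det : (V ≃ₗ[F] V) →* Fˣ).ker) (gradeS F V)
      (fun i : Fin r => if (i : ℕ) = 0 then k' s else k F V i)
      (fun i => if (i : ℕ) = 0 then ((Nat.card F : ℤ) ^ r - 1) / ((Nat.card F : ℤ) - 1)
        else (Nat.card F : ℤ) ^ r - (Nat.card F : ℤ) ^ (i : ℕ)) := by
  refine isPolynomialOn_invS hV (fun i => ?_) (fun γ hγ i => ?_) (fun n => ?_) fun γ hγ => ?_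
  · split_ifs
    exacts [k'_mem_gradeS hV s, k_mem_gradeS hV i.2.le]
  · split_ifs
    exacts [(actS_k'_eq_iff hs γ).2 hγ, actS_k γ i]
  · rw [← div_one ((vanishingPoly (vecL F V) ⊤).coeff n)]
    refine coeff_div_mem hV (fun j hj => ?_) n
    rw [div_one]
    rcases hj.lt_or_eq with hj | rfl
    · rcases Nat.eq_zero_or_pos j with rfl | hj0
      · obtain ⟨c, -, h⟩ := exists_coeff_one_eq_smul_k' hs
        rw [pow_zero, h]
        refine Subalgebra.smul_mem _ (pow_mem (Algebra.subset_adjoin ?_) _) c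
        exact ⟨⟨0, hj⟩, by simp⟩
      · exact Algebra.subset_adjoin ⟨⟨j, hj⟩, by simp [hj0.ne', algebraMap_k]⟩
    · rw [coeff_natCard_pow_vanishingPoly_top hV]
      exact one_mem _
  · rw [← actS_k'_eq_iff hs]
    simpa using hγ ⟨0, hr⟩

theorem isPolynomialOn_invR_det (hV : Module.finrank F V = r) (hr : 1 ≤ r)
    (hs : IsLineSection s) :
    IsPolynomialOn (invR (LinearEquiv.det : (V ≃ₗ[F] V) →* Fˣ).ker) (gradeR F V)
      (fun i : Fin r => if (i : ℕ) + 1 = r then h' s else h F V (i + 1))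
      (fun i => if (i : ℕ) + 1 = r then (1 - (Nat.card F : ℤ) ^ r) / ((Nat.card F : ℤ) - 1)
        else 1 - (Nat.card F : ℤ) ^ ((i : ℕ) + 1)) := by
  set x : Fin r → K F V := fun i => if (i : ℕ) + 1 = r then h' s else h F V (i + 1) with hx
  have hlast : x ⟨r - 1, by omega⟩ = h' s := if_pos (Nat.sub_add_cancel hr)
  have hk' : algebraMap (S F V) (K F V) (k' s) ∈ IntermediateField.adjoin F (Set.range x) := by
    have h := IntermediateField.subset_adjoin F (Set.range x) ⟨_, hlast⟩
    rw [← inv_inv (algebraMap (S F V) (K F V) (k' s))]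
    exact inv_mem h
  obtain ⟨c, -, hc⟩ := exists_coeff_one_eq_smul_k' hs
  refine isPolynomialOn_invR hV (fun i => ?_) (fun γ hγ i => ?_)
    coeff_one_vanishingPoly_top_ne_zero ?_ (coeff_div_mem hV fun j hj => ?_) fun γ hγ => ?_
  · simp only [hx]
    split_ifs
    exacts [h'_mem_gradeR hV hs, h_mem_gradeR hV i.2]
  · simp only [hx]
    split_ifs
    · rw [h', map_inv₀, actK_algebraMap, (actS_k'_eq_iff hs γ).2 hγ]
    · exact actK_h hV γ i.2
  · rw [hc, Algebra.smul_def]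
    exact mul_mem (IntermediateField.algebraMap_mem _ c) (pow_mem hk' _)
  · rw [← h_eq_div hV hj]
    rcases hj.lt_or_eq with hj | rfl
    · rcases j with _ | j
      · rw [h_eq_div hV hj.le, pow_zero, div_self coeff_one_vanishingPoly_top_ne_zero]
        exact one_mem _
      · exact Algebra.subset_adjoin ⟨⟨j, by omega⟩, if_neg hj.ne⟩
    · rw [h_finrank_eq hV, hc, Algebra.smul_def, mul_inv, ← map_inv₀, ← Algebra.smul_def, ← inv_pow]
      refine Subalgebra.smul_mem _ (pow_mem (Algebra.subset_adjoin ?_) _) _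
      exact ⟨_, hlast⟩
  · rw [← actS_k'_eq_iff hs]
    apply algebraMap_S_K_injective
    rw [← actK_algebraMap]
    exact hγ _ hk'

end Special

end RecipInv

end

theorem theorem2p1 (F : Type*) [Field F] [Finite F] (V : Type*) [AddCommGroup V] [Module F V]
    [Module.Finite F V] (q r : ℕ) (hq : Nat.card F = q) (hr : 1 ≤ r)
    (hV : Module.finrank F V = r) :
    -- the invariants under a maximal unipotent subgroup `U` of `Aut(V)`: parts (a) and (b)
    (∀ U : Subgroup (V ≃ₗ[F] V), Maximal RecipInv.IsUnipotentSubgroup U →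
      (∃ b : Module.Basis (Fin r) F V, RecipInv.IsUnitriangularIn U b) ∧
      ∀ b : Module.Basis (Fin r) F V, RecipInv.IsUnitriangularIn U b →
        RecipInv.IsPolynomialOn (RecipInv.invR U) (RecipInv.gradeR F V)
          (RecipInv.f b) (fun _ => -1) ∧
        RecipInv.IsPolynomialOn (RecipInv.invS U) (RecipInv.gradeS F V)
          (RecipInv.g b) (fun i => (q : ℤ) ^ (i : ℕ))) ∧
    -- the invariants under `G = Aut(V)`: parts (c) and (d)
    RecipInv.IsPolynomialOn (RecipInv.invR (⊤ : Subgroup (V ≃ₗ[F] V))) (RecipInv.gradeR F V)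
      (fun i : Fin r => RecipInv.h F V (i + 1)) (fun i => 1 - (q : ℤ) ^ ((i : ℕ) + 1)) ∧
    RecipInv.IsPolynomialOn (RecipInv.invS (⊤ : Subgroup (V ≃ₗ[F] V))) (RecipInv.gradeS F V)
      (fun i : Fin r => RecipInv.k F V i) (fun i => (q : ℤ) ^ r - (q : ℤ) ^ (i : ℕ)) ∧
    -- the invariants under `G'`, the automorphisms of determinant `1`: parts (e) and (f)
    (∀ s : Projectivization F V → V, RecipInv.IsLineSection s →
      RecipInv.IsPolynomialOn
        (RecipInv.invR (LinearEquiv.det : (V ≃ₗ[F] V) →* Fˣ).ker) (RecipInv.gradeR F V)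
        (fun i : Fin r => if (i : ℕ) + 1 = r then RecipInv.h' s else RecipInv.h F V (i + 1))
        (fun i => if (i : ℕ) + 1 = r then (1 - (q : ℤ) ^ r) / ((q : ℤ) - 1)
          else 1 - (q : ℤ) ^ ((i : ℕ) + 1)) ∧
      RecipInv.IsPolynomialOn
        (RecipInv.invS (LinearEquiv.det : (V ≃ₗ[F] V) →* Fˣ).ker) (RecipInv.gradeS F V)
        (fun i : Fin r => if (i : ℕ) = 0 then RecipInv.k' s else RecipInv.k F V i)
        (fun i => if (i : ℕ) = 0 then ((q : ℤ) ^ r - 1) / ((q : ℤ) - 1)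
          else (q : ℤ) ^ r - (q : ℤ) ^ (i : ℕ))) := by

  subst hq
  have := Module.finite_of_finite F (M := V)
  refine ⟨fun U hU => ⟨RecipInv.exists_isUnitriangularIn hV hU, fun b hb =>
    ⟨RecipInv.isPolynomialOn_invR_unitriangular b hV hb,
      RecipInv.isPolynomialOn_invS_unitriangular b hV hb⟩⟩,
    RecipInv.isPolynomialOn_invR_top hr hV, RecipInv.isPolynomialOn_invS_top hV, fun s hs =>
    ⟨RecipInv.isPolynomialOn_invR_det hV hr hs, RecipInv.isPolynomialOn_invS_det hV hr hs⟩⟩
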